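/- **Setting.** Let $W,\widetilde W$ be independent standard Brownian motions and let $(X_0,Y_0)$ be real random variables independent of $(W,\widetilde W)$. For deterministic functions $b,\sigma,\widetilde\sigma$ on $[0,1]$ with $\sigma,\widetilde\sigma>0$ let $P_{b,\sigma,\widetilde\sigma}$ be the law of the process $$X_t=X_0+\int_0^t\sigma_s\,dW_s,\qquad Y_t=Y_0+\int_0^t b_s\sigma_s\,dW_s+\int_0^t\widetilde\sigma_s\,d\widetilde W_s,\qquad t\in[0,1],$$ which has no drift and no jumps. A test $\psi_n$ is a measurable $\{0,1\}$-valued function of the observations $(X_{i/n},Y_{i/n})_{0\le i\le n}$. For $\alpha\in(0,1]$, let $C^\alpha(R)$ be the set of $f:[0,1]\to\mathbb R$ with $|f(t)-f(s)|\le R|t-s|^\alpha$ and $|f(t)|\le R$ for all $s,t\in[0,1]$, and let $\mathcal V_\alpha(m,M,L)$ be the set of functions $\sigma:[0,1]\to(0,\infty)$ with $m\le\sigma_t^2\le M$ and $|\sigma_t^2-\sigma_s^2|\le L|t-s|^\alpha$ for all $s,t\in[0,1]$. For $r\ge0$ and a constant $\beta$ the alternative $H_{1,\alpha}(r)=H_{1,\alpha}(r;\beta,R,m,M,L)$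 is the set of all laws $P_{b,\sigma,\widetilde\sigma}$ with $b\in C^\alpha(R)$, $\sigma,\widetilde\sigma\in\mathcal V_\alpha(m,M,L)$ and $$\int_0^1\frac{\sigma_t^2(b_t-\beta)^2}{\sigma_t^2(b_t-\beta)^2+\widetilde\sigma_t^2}\,dt\ \ge\ r^2 ,$$ so that the volatilities are nuisance parameters which may vary with $b$. **Theorem.** Let $\alpha\in(0,1]$, $\gamma\in(0,1)$, $0<\beta<R$, $m_0>0$ and $M_0\in\mathbb R$, and put $r_n=n^{-2\alpha/(4\alpha+1)}$. There is a $\widetilde\Gamma>0$ such that for all $0<m<m_0$, $M>M_0$, all $L_0<L$ and all volatilities $\sigma_0,\widetilde\sigma_0\in\mathcal V_\alpha(m_0,M_0,L_0)$ of the null hypothesis, $P_\beta:=P_{\beta,\sigma_0,\widetilde\sigma_0}$ satisfies $$\liminf_{n\to\infty}\ \inf_{\psi_n}\Big(P_\beta(\psi_n=1)+\sup_{Q\in H_{1,\alpha}(\widetilde\Gamma r_n;\,\beta,R,m,M,L)}Q(\psi_n=0)\Big)\ \ge\ \gamma ,$$ where the infimum is over all tests based on the $n+1$ observations. -/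

import Mathlib

open MeasureTheory ProbabilityTheory Filter Topology
open scoped NNReal ENNReal

namespace ConstantBeta

/-- The integral up to time `t` against `W` of the step function that equals `f (k / 2 ^ m)` on
`(k / 2 ^ m, (k + 1) / 2 ^ m]`, `k < 2 ^ m`. -/
noncomputable def wienerSum {Ω : Type*} (W : ℝ≥0 → Ω → ℝ) (f : ℝ → ℝ) (m : ℕ) (t : ℝ≥0)
    (ω : Ω) : ℝ :=
  ∑ k ∈ Finset.range (2 ^ m), f ((k : ℝ) / 2 ^ m) *
    (W (min t (((k : ℝ≥0) + 1) / 2 ^ m)) ω - W (min t ((k : ℝ≥0) / 2 ^ m)) ω)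

/-- `I` is (a version of) the stochastic integral `∫₀ᵗ f dW` of the deterministic function `f`,
for `f` continuous on `[0, 1]` and `t ≤ 1`: the mean-square limit of the integrals of the step
functions that interpolate `f` along the dyadic partitions. -/
def IsWienerIntegral {Ω : Type*} [MeasurableSpace Ω] (P : Measure Ω) (W : ℝ≥0 → Ω → ℝ)
    (f : ℝ → ℝ) (t : ℝ≥0) (I : Ω → ℝ) : Prop :=
  Measurable I ∧
    Tendsto (fun m : ℕ => eLpNorm (fun ω => wienerSum W f m t ω - I ω) 2 P) atTop (𝓝 0)

open Classical in
/-- The stochastic integral `∫₀ᵗ f dW` of a deterministic function (unique up to null sets; the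
limit exists whenever `W` is a Brownian motion, `f` is continuous on `[0, 1]` and `t ≤ 1`). -/
noncomputable def wienerIntegral {Ω : Type*} [MeasurableSpace Ω] (P : Measure Ω)
    (W : ℝ≥0 → Ω → ℝ) (f : ℝ → ℝ) (t : ℝ≥0) : Ω → ℝ :=
  if h : ∃ I : Ω → ℝ, IsWienerIntegral P W f t I then h.choose else 0

/-- The driving noise: two independent standard Brownian motions `W`, `W'` and initial values
`X₀`, `Y₀` independent of them. -/
structure IsNoise {Ω : Type*} [MeasurableSpace Ω] (P : Measure Ω) (W W' : ℝ≥0 → Ω → ℝ)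
    (X₀ Y₀ : Ω → ℝ) : Prop where
  brownian_fst : IsBrownianReal W P
  brownian_snd : IsBrownianReal W' P
  indep : IndepFun (fun ω t => W t ω) (fun ω t => W' t ω) P
  measurable_init_fst : Measurable X₀
  measurable_init_snd : Measurable Y₀
  indep_init : IndepFun (fun ω => (X₀ ω, Y₀ ω)) (fun ω t => (W t ω, W' t ω)) P

/-- The law, on the space of paths `[0, 1] → ℝ × ℝ` with the product σ-algebra, of
`X_t = X₀ + ∫₀ᵗ σ dW`, `Y_t = Y₀ + ∫₀ᵗ b σ dW + ∫₀ᵗ τ dW'`. This law is determined by the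
finite-dimensional distributions, so it does not depend on the versions of the integrals. -/
noncomputable def pathLaw {Ω : Type*} [MeasurableSpace Ω] (P : Measure Ω) (W W' : ℝ≥0 → Ω → ℝ)
    (X₀ Y₀ : Ω → ℝ) (b σ τ : ℝ → ℝ) : Measure (unitInterval → ℝ × ℝ) :=
  P.map fun ω t =>
    (X₀ ω + wienerIntegral P W σ (unitInterval.toNNReal t) ω,
      Y₀ ω + wienerIntegral P W (fun s => b s * σ s) (unitInterval.toNNReal t) ω
        + wienerIntegral P W' τ (unitInterval.toNNReal t) ω)

/-- The Hölder ball `C^α(R)` of functions on `[0, 1]`. -/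
def holderBall (α R : ℝ) : Set (ℝ → ℝ) :=
  {f | (∀ s ∈ Set.Icc (0 : ℝ) 1, ∀ t ∈ Set.Icc (0 : ℝ) 1, |f t - f s| ≤ R * |t - s| ^ α) ∧
    ∀ t ∈ Set.Icc (0 : ℝ) 1, |f t| ≤ R}

/-- Positive volatility functions `σ` on `[0, 1]` with `m ≤ σ² ≤ M` whose square is `α`-Hölder
with constant `L`. -/
def volClass (α m M L : ℝ) : Set (ℝ → ℝ) :=
  {σ | (∀ t ∈ Set.Icc (0 : ℝ) 1, 0 < σ t ∧ m ≤ σ t ^ 2 ∧ σ t ^ 2 ≤ M) ∧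
    ∀ s ∈ Set.Icc (0 : ℝ) 1, ∀ t ∈ Set.Icc (0 : ℝ) 1, |σ t ^ 2 - σ s ^ 2| ≤ L * |t - s| ^ α}

/-- The squared weighted `L²`-distance between `b` and the constant `β`. -/
noncomputable def sqSeparation (β : ℝ) (b σ τ : ℝ → ℝ) : ℝ :=
  ∫ t in (0 : ℝ)..1, σ t ^ 2 * (b t - β) ^ 2 / (σ t ^ 2 * (b t - β) ^ 2 + τ t ^ 2)

/-- The alternative `H_{1,α}(r)` within the Gaussian model: the laws of `(X, Y)` with beta function
in `C^α(R)` and separated from `β` by at least `r`; the volatilities are free nuisance parameters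
with squares in `[m, M]` and Hölder constant `L`. -/
def alternative {Ω : Type*} [MeasurableSpace Ω] (P : Measure Ω) (W W' : ℝ≥0 → Ω → ℝ)
    (X₀ Y₀ : Ω → ℝ) (α R m M L β r : ℝ) : Set (Measure (unitInterval → ℝ × ℝ)) :=
  {Q | ∃ b σ τ : ℝ → ℝ, b ∈ holderBall α R ∧ σ ∈ volClass α m M L ∧ τ ∈ volClass α m M L ∧
    r ^ 2 ≤ sqSeparation β b σ τ ∧ Q = pathLaw P W W' X₀ Y₀ b σ τ}

/-- The observations of a path at the times `i / n`, `i = 0, …, n`. -/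
noncomputable def observe (n : ℕ) (x : unitInterval → ℝ × ℝ) (i : Fin (n + 1)) : ℝ × ℝ :=
  x ⟨(i : ℝ) / n, unitInterval.div_mem (Nat.cast_nonneg _) (Nat.cast_nonneg _)
    (Nat.cast_le.2 (Nat.lt_succ_iff.1 i.2))⟩

/-- The infimum, over all tests `ψ` based on the `n + 1` observations, of the sum of the error
probability of the first kind under `Q₀` and the maximal one of the second kind over `H₁`. -/
noncomputable def minimaxError (n : ℕ) (Q₀ : Measure (unitInterval → ℝ × ℝ))
    (H₁ : Set (Measure (unitInterval → ℝ × ℝ))) : ℝ≥0∞ :=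
  ⨅ (ψ : (Fin (n + 1) → ℝ × ℝ) → Fin 2) (_ : Measurable ψ),
    Q₀ {x | ψ (observe n x) = 1} + ⨆ Q ∈ H₁, Q {x | ψ (observe n x) = 0}

end ConstantBeta

/-! With deterministic coefficients the observations amount to the initial value and `n` independent
centred Gaussian increments in the plane. Their law involves `(b, σ, τ)` only through the integrals
of `σ²`, `bσ²` and `b²σ² + τ²` over the observation intervals (`map_startIncrements`). After
dividing by the null volatilities, all that can distinguish the laws used below from the null law is
one regression coefficient per increment (`pathLaw_eq_shearedLaw`).

To achieve this, keep `σ₀` and perturb `β` to `β + δ` with `δ = g / σ₀²`. On each interval this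
raises the conditional variance of the `Y`-increment given the `X`-increment by the Cauchy-Schwarz
defect of `δ`, which is of order `n^(-2α)` times the interval length. Subtracting bumps with exactly
these integrals from `τ₀²` restores the conditional variance. The bumps have Hölder constant of
order `n^(-α)`, so the slack `m < m₀`, `L₀ < L` absorbs them for large `n` (`exists_alternative`).

If `α ≤ 1/4`, let `g` alternate at frequency `2n` with amplitude of order `n^(-α)`, the most that
the Hölder constraint allows. Every interval integral of `g` vanishes, so the observations have
exactly the null law, and `n^(-α)` is at least `r_n`.

If `α > 1/4`, let `g` carry independent random signs on blocks of `K ≈ κ n^(1-p)` intervals, `p =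
2/(4α+1)`, with amplitude of order `(K/n)^α`. The second moment of the mixture's likelihood ratio is
at most `exp(C n K a⁴)` for amplitude `a`, and `n K a⁴` is of order `n² (K/n)^(4α+1)`, which is
small with `κ`. A second moment at most `1 + c²` keeps the total error above `1 - c`
(`exists_sign_measure_le`, `le_minimaxError`); take `c = 1 - γ`. -/

namespace ConstantBeta

/-! ### Gaussian variables in the linear span of a Brownian motion. -/

section LinearSpan

variable {Ω : Type*} {W : ℝ≥0 → Ω → ℝ} {Z : Ω → ℝ}

/-- An element of the linear span of a process is a measurable function of its path. -/
lemma exists_measurable_of_mem_span (hZ : Z ∈ Submodule.span ℝ (Set.range W)) :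
    ∃ φ : (ℝ≥0 → ℝ) → ℝ, Measurable φ ∧ Z = fun ω => φ (fun t => W t ω) := by
  induction hZ using Submodule.span_induction with
  | mem x hx =>
    obtain ⟨t, rfl⟩ := hx
    exact ⟨fun w => w t, measurable_pi_apply t, rfl⟩
  | zero => exact ⟨fun _ => 0, measurable_const, rfl⟩
  | add x y _ _ hx hy =>
    obtain ⟨φ, hφ, rfl⟩ := hx
    obtain ⟨ψ, hψ, rfl⟩ := hy
    exact ⟨fun w => φ w + ψ w, hφ.add hψ, rfl⟩
  | smul c x _ hx =>
    obtain ⟨φ, hφ, rfl⟩ := hx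
    exact ⟨fun w => c * φ w, hφ.const_mul c, rfl⟩

variable [MeasurableSpace Ω] {P : Measure Ω}

/-- The linear span of a Gaussian process consists of Gaussian variables. -/
lemma hasGaussianLaw_of_mem_span (hW : IsGaussianProcess W P)
    (hZ : Z ∈ Submodule.span ℝ (Set.range W)) : HasGaussianLaw Z P := by
  rw [Finsupp.mem_span_range_iff_exists_finsupp] at hZ
  obtain ⟨c, rfl⟩ := hZ
  exact (hW.smul c).hasGaussianLaw_sum (I := c.support)

lemma integral_eq_zero_of_mem_span (hW : IsPreBrownianReal W P)
    (hZ : Z ∈ Submodule.span ℝ (Set.range W)) : P[Z] = 0 := by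
  induction hZ using Submodule.span_induction with
  | mem x hx =>
    obtain ⟨t, rfl⟩ := hx
    exact hW.integral_eval t
  | zero => simp
  | add x y hx hy ihx ihy =>
    rw [Pi.add_def, integral_add (hasGaussianLaw_of_mem_span hW.isGaussianProcess hx).integrable
      (hasGaussianLaw_of_mem_span hW.isGaussianProcess hy).integrable, ihx, ihy, add_zero]
  | smul c x _ hx => simp only [Pi.smul_apply, integral_smul, hx, smul_zero]

/-- The characteristic function at `1` of an element of the span of a Brownian motion. -/
lemma charFun_map_one_of_mem_span (hW : IsPreBrownianReal W P)
    (hZ : Z ∈ Submodule.span ℝ (Set.range W)) :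
    charFun (P.map Z) 1 = Complex.exp (-(Var[Z; P] : ℂ) / 2) := by
  rw [(hasGaussianLaw_of_mem_span hW.isGaussianProcess hZ).charFun_map_eq]
  simp [integral_eq_zero_of_mem_span hW hZ, neg_div]

end LinearSpan

/-! ### Integrals of step functions and their covariances. -/

section WienerSum

variable {Ω : Type*} {W : ℝ≥0 → Ω → ℝ}

lemma wienerSum_mem_span (f : ℝ → ℝ) (m : ℕ) (t : ℝ≥0) :
    wienerSum W f m t ∈ Submodule.span ℝ (Set.range W) := by
  have : wienerSum W f m t = ∑ k ∈ Finset.range (2 ^ m), f ((k : ℝ) / 2 ^ m) •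
      (W (min t (((k : ℝ≥0) + 1) / 2 ^ m)) - W (min t ((k : ℝ≥0) / 2 ^ m))) := by
    ext ω
    simp [wienerSum]
  rw [this]
  exact Submodule.sum_mem _ fun k _ => Submodule.smul_mem _ _ <|
    Submodule.sub_mem _ (Submodule.subset_span ⟨_, rfl⟩) (Submodule.subset_span ⟨_, rfl⟩)

lemma wienerSum_time_zero (W : ℝ≥0 → Ω → ℝ) (f : ℝ → ℝ) (m : ℕ) : wienerSum W f m 0 = 0 := by
  ext ω
  simp [wienerSum]

lemma wienerSum_sub (f g : ℝ → ℝ) (m : ℕ) (t : ℝ≥0) :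
    wienerSum W (fun x => f x - g x) m t = wienerSum W f m t - wienerSum W g m t := by
  ext ω
  simp [wienerSum, sub_mul, Finset.sum_sub_distrib]

lemma wienerSum_const_mul (c : ℝ) (f : ℝ → ℝ) (m : ℕ) (t : ℝ≥0) :
    wienerSum W (fun x => c * f x) m t = c • wienerSum W f m t := by
  ext ω
  simp [wienerSum, Finset.mul_sum, mul_assoc]

lemma wienerSum_add (f g : ℝ → ℝ) (m : ℕ) (t : ℝ≥0) :
    wienerSum W (fun x => f x + g x) m t = wienerSum W f m t + wienerSum W g m t := by
  ext ω
  simp [wienerSum, add_mul, Finset.sum_add_distrib]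

variable [MeasurableSpace Ω] {P : Measure Ω}

lemma memLp_of_mem_span {Z : Ω → ℝ} (hW : IsPreBrownianReal W P)
    (hZ : Z ∈ Submodule.span ℝ (Set.range W)) : MemLp Z 2 P :=
  (hasGaussianLaw_of_mem_span hW.isGaussianProcess hZ).memLp_two

/-- The left Riemann sum of `φ` over `[0, t]` along the dyadic partition of level `m`. -/
noncomputable def riemannSum (φ : ℝ → ℝ) (m : ℕ) (t : ℝ) : ℝ :=
  ∑ k ∈ Finset.range (2 ^ m), φ ((k : ℝ) / 2 ^ m) *
    (min t (((k : ℝ) + 1) / 2 ^ m) - min t ((k : ℝ) / 2 ^ m))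

lemma covariance_brownian_increments (hW : IsPreBrownianReal W P) (s s' t t' : ℝ≥0) :
    cov[fun ω => W s' ω - W s ω, fun ω => W t' ω - W t ω; P] =
      min (s' : ℝ) t' - min (s' : ℝ) t - min (s : ℝ) t' + min (s : ℝ) t := by
  have := hW.isGaussianProcess.isProbabilityMeasure
  have h (r : ℝ≥0) : MemLp (W r) 2 P := (hW.isGaussianProcess.hasGaussianLaw_eval r).memLp_two
  rw [covariance_fun_sub_fun_sub (h _) (h _) (h _) (h _)]
  simp [hW.covariance_fun_eval]

/-- Increments over disjoint dyadic intervals are uncorrelated, so only the diagonal of the double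
sum survives; stopping at `s` and at `t` leaves the part before `min s t`. -/
lemma covariance_wienerSum (hW : IsPreBrownianReal W P) (f g : ℝ → ℝ) (m : ℕ) (s t : ℝ≥0) :
    cov[wienerSum W f m s, wienerSum W g m t; P] =
      riemannSum (fun x => f x * g x) m (min (s : ℝ) t) := by
  have := hW.isGaussianProcess.isProbabilityMeasure
  have h (r : ℝ≥0) : MemLp (W r) 2 P := (hW.isGaussianProcess.hasGaussianLaw_eval r).memLp_two
  have hmem (f : ℝ → ℝ) (t : ℝ≥0) (k : ℕ) :
      MemLp (fun ω => f ((k : ℝ) / 2 ^ m) * (W (min t (((k : ℝ≥0) + 1) / 2 ^ m)) ω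
        - W (min t ((k : ℝ≥0) / 2 ^ m)) ω)) 2 P := ((h _).sub (h _)).const_mul _
  unfold wienerSum riemannSum
  rw [covariance_fun_sum_fun_sum' (fun k _ => hmem f s k) (fun k _ => hmem g t k)]
  refine Finset.sum_congr rfl fun k hk => ?_
  have hmin (x y : ℝ) : min (min (s : ℝ) x) (min (t : ℝ) y) = min (min (s : ℝ) t) (min x y) := by
    rw [min_min_min_comm]
  rw [Finset.sum_eq_single_of_mem k hk]
  · rw [covariance_const_mul_left, covariance_const_mul_right, covariance_brownian_increments hW]
    push_cast
    simp only [hmin]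
    have : (k : ℝ) / 2 ^ m ≤ ((k : ℝ) + 1) / 2 ^ m := by gcongr; linarith
    rw [min_self, min_self, min_eq_right this, min_eq_left this]
    ring
  · intro l _ hl
    rw [covariance_const_mul_left, covariance_const_mul_right, covariance_brownian_increments hW]
    push_cast
    simp only [hmin]
    have hmono (i j : ℕ) (hij : i < j) : ((i : ℝ) + 1) / 2 ^ m ≤ (j : ℝ) / 2 ^ m ∧
      (i : ℝ) / 2 ^ m ≤ (j : ℝ) / 2 ^ m ∧ (i : ℝ) / 2 ^ m ≤ ((j : ℝ) + 1) / 2 ^ m ∧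
        ((i : ℝ) + 1) / 2 ^ m ≤ ((j : ℝ) + 1) / 2 ^ m := by
      have : (i : ℝ) + 1 ≤ j := by exact_mod_cast hij
      refine ⟨?_, ?_, ?_, ?_⟩ <;>
        exact div_le_div_of_nonneg_right (by linarith) (by positivity)
    rcases lt_or_gt_of_ne hl with hlk | hlk
    · obtain ⟨h1, h2, h3, h4⟩ := hmono l k hlk
      rw [min_eq_right h1, min_eq_right h2, min_eq_right h3, min_eq_right h4]
      ring
    · obtain ⟨h1, h2, h3, h4⟩ := hmono k l hlk
      rw [min_eq_left h1, min_eq_left h2, min_eq_left h3, min_eq_left h4]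
      ring

end WienerSum

/-! ### Convergence of dyadic Riemann sums. -/

section Riemann

lemma riemannSum_one (m : ℕ) {t : ℝ} (ht0 : 0 ≤ t) (ht1 : t ≤ 1) :
    riemannSum (fun _ => 1) m t = t := by
  have := Finset.sum_range_sub (fun k : ℕ => min t ((k : ℝ) / 2 ^ m)) (2 ^ m)
  simp only [Nat.cast_add, Nat.cast_one, Nat.cast_pow, Nat.cast_ofNat] at this
  simp only [riemannSum, one_mul, this]
  rw [div_self (by positivity), min_eq_left ht1]
  simp [ht0]

lemma riemannSum_weight_nonneg (m k : ℕ) (t : ℝ) :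
    0 ≤ min t (((k : ℝ) + 1) / 2 ^ m) - min t ((k : ℝ) / 2 ^ m) := by
  rw [sub_nonneg]
  gcongr
  linarith

lemma dyadic_mem_Icc {m k : ℕ} (hk : k ∈ Finset.range (2 ^ m)) :
    (k : ℝ) / 2 ^ m ∈ Set.Icc (0 : ℝ) 1 := by
  refine ⟨by positivity, ?_⟩
  rw [div_le_one (by positivity)]
  exact_mod_cast (Finset.mem_range.1 hk).le

/-- Riemann sums of a function that is small on `[0, 1]` are small. -/
lemma riemannSum_le {φ : ℝ → ℝ} {ε : ℝ} (hε : 0 ≤ ε) (m : ℕ)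
    (hφ : ∀ k ∈ Finset.range (2 ^ m), φ ((k : ℝ) / 2 ^ m) ≤ ε)
    {t : ℝ} (ht0 : 0 ≤ t) (ht1 : t ≤ 1) : riemannSum φ m t ≤ ε := by
  calc riemannSum φ m t ≤ ε * riemannSum (fun _ => 1) m t := by
        unfold riemannSum
        rw [Finset.mul_sum]
        refine Finset.sum_le_sum fun k hk => ?_
        rw [one_mul]
        exact mul_le_mul_of_nonneg_right (hφ k hk) (riemannSum_weight_nonneg m k t)
    _ ≤ ε := by
        rw [riemannSum_one m ht0 ht1]
        nlinarith

lemma tendsto_two_pow_inv : Tendsto (fun m : ℕ => ((2 : ℝ) ^ m)⁻¹) atTop (𝓝 0) := by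
  simpa using tendsto_pow_atTop_nhds_zero_of_lt_one (r := (2 : ℝ)⁻¹) (by norm_num) (by norm_num)

/-- Uniform continuity at dyadic scales. -/
lemma eventually_dyadic_close {φ : ℝ → ℝ} (hφ : ContinuousOn φ (Set.Icc 0 1)) {ε : ℝ}
    (hε : 0 < ε) : ∀ᶠ m : ℕ in atTop, ∀ x ∈ Set.Icc (0 : ℝ) 1, ∀ y ∈ Set.Icc (0 : ℝ) 1,
      |x - y| ≤ ((2 : ℝ) ^ m)⁻¹ → |φ x - φ y| ≤ ε := by
  have huc := isCompact_Icc.uniformContinuousOn_of_continuous hφ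
  obtain ⟨δ, hδ, h⟩ := Metric.uniformContinuousOn_iff_le.1 huc ε hε
  filter_upwards [tendsto_two_pow_inv.eventually_le_const hδ] with m hm x hx y hy hxy
  exact h x hx y hy (hxy.trans hm)

lemma tendsto_riemannSum {φ : ℝ → ℝ} (hφ : ContinuousOn φ (Set.Icc 0 1)) {t : ℝ}
    (ht0 : 0 ≤ t) (ht1 : t ≤ 1) :
    Tendsto (fun m => riemannSum φ m t) atTop (𝓝 (∫ x in (0 : ℝ)..t, φ x)) := by
  rw [Metric.tendsto_atTop']
  intro ε hε
  obtain ⟨N, hN⟩ := eventually_atTop.1 (eventually_dyadic_close hφ (half_pos hε))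
  refine ⟨N, fun m hm => lt_of_le_of_lt ?_ (half_lt_self hε)⟩
  -- Clipping the dyadic points at `t` partitions `[0, t]`; the cells beyond `t` become empty.
  set a : ℕ → ℝ := fun k => min t ((k : ℝ) / 2 ^ m) with ha
  have ha01 (k : ℕ) : a k ∈ Set.Icc (0 : ℝ) 1 :=
    ⟨le_min ht0 (by positivity), (min_le_left _ _).trans ht1⟩
  have hasucc (k : ℕ) : a (k + 1) = min t (((k : ℝ) + 1) / 2 ^ m) := by simp [ha]
  have hamono (k : ℕ) : a k ≤ a (k + 1) := by
    rw [hasucc, ← sub_nonneg]; exact riemannSum_weight_nonneg m k t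
  have hint (k : ℕ) : IntervalIntegrable φ volume (a k) (a (k + 1)) := by
    refine (hφ.mono ?_).intervalIntegrable
    rw [Set.uIcc_of_le (hamono k)]
    exact Set.Icc_subset_Icc (ha01 k).1 (ha01 (k + 1)).2
  have hsum : ∫ x in (0 : ℝ)..t, φ x =
      ∑ k ∈ Finset.range (2 ^ m), ∫ x in a k..a (k + 1), φ x := by
    rw [intervalIntegral.sum_integral_adjacent_intervals fun k _ => hint k]
    simp [ha, ht0, ht1]
  have hdiff : riemannSum φ m t - ∫ x in (0 : ℝ)..t, φ x =
      ∑ k ∈ Finset.range (2 ^ m), ∫ x in a k..a (k + 1), (φ ((k : ℝ) / 2 ^ m) - φ x) := by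
    rw [hsum, riemannSum, ← Finset.sum_sub_distrib]
    refine Finset.sum_congr rfl fun k _ => ?_
    rw [intervalIntegral.integral_sub intervalIntegrable_const (hint k),
      intervalIntegral.integral_const, smul_eq_mul, hasucc]
    ring
  rw [Real.dist_eq, hdiff]
  calc |∑ k ∈ Finset.range (2 ^ m), ∫ x in a k..a (k + 1), (φ ((k : ℝ) / 2 ^ m) - φ x)|
      ≤ ∑ k ∈ Finset.range (2 ^ m), ε / 2 * (a (k + 1) - a k) := by
        refine (Finset.abs_sum_le_sum_abs _ _).trans (Finset.sum_le_sum fun k hk => ?_)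
        rw [← abs_of_nonneg (sub_nonneg.2 (hamono k)), ← Real.norm_eq_abs (∫ x in _.._, _)]
        refine intervalIntegral.norm_integral_le_of_norm_le_const fun x hx => ?_
        rw [Set.uIoc_of_le (hamono k)] at hx
        have hx' : x ∈ Set.Icc (0 : ℝ) 1 :=
          ⟨(ha01 k).1.trans hx.1.le, hx.2.trans (ha01 (k + 1)).2⟩
        refine hN m hm.le _ (dyadic_mem_Icc hk) x hx' ?_
        -- A cell that contains a point starts before `t`, so its left end is the unclipped dyadic
        -- point at which the Riemann sum evaluates `φ`.
        have hak : a k = (k : ℝ) / 2 ^ m := by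
          rcases min_choice t ((k : ℝ) / 2 ^ m) with h | h
          · exfalso
            have h1 : a (k + 1) ≤ t := min_le_left _ _
            have h2 : a k = t := h
            linarith [hx.1, hx.2]
          · exact h
        have h3 : x ≤ ((k : ℝ) + 1) / 2 ^ m := hx.2.trans (by rw [hasucc]; exact min_le_right _ _)
        rw [add_div, one_div] at h3
        rw [abs_sub_comm, abs_of_nonneg] <;> linarith [hx.1]
    _ ≤ ε / 2 := by
        rw [← Finset.mul_sum, Finset.sum_range_sub]
        have : a (2 ^ m) - a 0 ≤ 1 := by linarith [(ha01 (2 ^ m)).2, (ha01 0).1]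
        nlinarith

end Riemann

/-! ### Existence of the Wiener integral. -/

section Existence

variable {Ω : Type*} {W : ℝ≥0 → Ω → ℝ}

/-- The dyadic step function of level `m` that interpolates `f` from the left. -/
noncomputable def dyadicStep (f : ℝ → ℝ) (m : ℕ) (x : ℝ) : ℝ :=
  f ((⌊(2 : ℝ) ^ m * x⌋₊ : ℝ) / 2 ^ m)

lemma sum_range_two_mul (a : ℕ → ℝ) (n : ℕ) :
    ∑ k ∈ Finset.range (2 * n), a k = ∑ k ∈ Finset.range n, (a (2 * k) + a (2 * k + 1)) := by
  induction n with
  | zero => simp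
  | succ n ih => rw [Finset.sum_range_succ, ← ih, mul_add, mul_one, Finset.sum_range_succ,
      Finset.sum_range_succ]; ring

lemma dyadicStep_dyadic (f : ℝ → ℝ) (m d k : ℕ) :
    dyadicStep f m ((k : ℝ) / 2 ^ (m + d)) = f (((k / 2 ^ d : ℕ) : ℝ) / 2 ^ m) := by
  have : (2 : ℝ) ^ m * ((k : ℝ) / 2 ^ (m + d)) = (k : ℝ) / ((2 ^ d : ℕ) : ℝ) := by
    push_cast
    rw [pow_add]
    field_simp
  rw [dyadicStep, this, Nat.floor_div_eq_div]

/-- Refining the partition does not change the integral of a step function. Two levels of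
approximation can therefore be compared as integrals over one common partition. -/
lemma wienerSum_dyadicStep (f : ℝ → ℝ) (m d : ℕ) (t : ℝ≥0) :
    wienerSum W (dyadicStep f m) (m + d) t = wienerSum W f m t := by
  induction d with
  | zero =>
    ext ω
    refine Finset.sum_congr rfl fun k _ => ?_
    rw [dyadicStep_dyadic]
    simp
  | succ d ih =>
    rw [← ih]
    ext ω
    unfold wienerSum
    rw [← add_assoc, pow_succ' 2 (m + d), sum_range_two_mul]
    refine Finset.sum_congr rfl fun k _ => ?_
    rw [add_assoc m d 1, dyadicStep_dyadic, dyadicStep_dyadic, dyadicStep_dyadic]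
    have h1 : 2 * k / 2 ^ (d + 1) = k / 2 ^ d := by
      rw [pow_succ', Nat.mul_div_mul_left _ _ two_pos]
    have h2 : (2 * k + 1) / 2 ^ (d + 1) = k / 2 ^ d := by
      rw [pow_succ', ← Nat.div_div_eq_div_mul]; congr 1; omega
    rw [h1, h2, ← mul_add]
    congr 1
    have e (x : ℝ≥0) : 2 * x / 2 ^ (m + (d + 1)) = x / 2 ^ (m + d) := by
      rw [← add_assoc, pow_succ', mul_div_mul_left _ _ two_ne_zero]
    have e1 : ((2 * k + 1 : ℕ) : ℝ≥0) + 1 = 2 * ((k : ℝ≥0) + 1) := by push_cast; ring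
    rw [e1, e, show ((2 * k : ℕ) : ℝ≥0) = 2 * (k : ℝ≥0) by push_cast; ring, e]
    push_cast
    ring

lemma floor_dyadic_close {x : ℝ} (hx : x ∈ Set.Icc (0 : ℝ) 1) (m : ℕ) :
    (⌊(2 : ℝ) ^ m * x⌋₊ : ℝ) / 2 ^ m ∈ Set.Icc (0 : ℝ) 1 ∧
      |x - (⌊(2 : ℝ) ^ m * x⌋₊ : ℝ) / 2 ^ m| ≤ ((2 : ℝ) ^ m)⁻¹ := by
  have hp : (0 : ℝ) < 2 ^ m := by positivity
  have h1 := Nat.floor_le (mul_nonneg hp.le hx.1)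
  have h2 := (Nat.lt_floor_add_one ((2 : ℝ) ^ m * x)).le
  have h3 : (⌊(2 : ℝ) ^ m * x⌋₊ : ℝ) / 2 ^ m ≤ x := by rw [div_le_iff₀ hp]; linarith
  refine ⟨⟨by positivity, h3.trans hx.2⟩, ?_⟩
  rw [abs_of_nonneg (sub_nonneg.2 h3), sub_le_iff_le_add, ← one_div, ← add_div, le_div_iff₀ hp]
  linarith

variable [MeasurableSpace Ω] {P : Measure Ω}

lemma eLpNorm_two_eq_of_mem_span {Z : Ω → ℝ} (hW : IsPreBrownianReal W P)
    (hZ : Z ∈ Submodule.span ℝ (Set.range W)) :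
    eLpNorm Z 2 P = ENNReal.ofReal (√Var[Z; P]) := by
  have hL := memLp_of_mem_span hW hZ
  rw [hL.eLpNorm_eq_integral_rpow_norm (by norm_num) (by norm_num),
    variance_of_integral_eq_zero hL.aemeasurable (integral_eq_zero_of_mem_span hW hZ),
    Real.sqrt_eq_rpow]
  simp

/-- The dyadic approximations of a stochastic integral converge in mean square. -/
lemma exists_isWienerIntegral (hW : IsPreBrownianReal W P) {f : ℝ → ℝ}
    (hf : ContinuousOn f (Set.Icc 0 1)) {t : ℝ≥0} (ht : t ≤ 1) :
    ∃ I : Ω → ℝ, IsWienerIntegral P W f t I := by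
  have hmem (m : ℕ) : MemLp (wienerSum W f m t) 2 P :=
    memLp_of_mem_span hW (wienerSum_mem_span f m t)
  have hclose (ε : ℝ) (hε : 0 < ε) : ∀ᶠ m : ℕ in atTop, ∀ M ≥ m,
      eLpNorm (wienerSum W f M t - wienerSum W f m t) 2 P ≤ ENNReal.ofReal ε := by
    filter_upwards [eventually_dyadic_close hf hε] with m hm M hM
    obtain ⟨d, rfl⟩ := Nat.exists_eq_add_of_le hM
    -- At the common level the difference is a single Wiener sum, whose variance is a Riemann sum of
    -- squared oscillations of `f`.
    rw [← wienerSum_dyadicStep f m d t, ← wienerSum_sub,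
      eLpNorm_two_eq_of_mem_span hW (wienerSum_mem_span _ _ _)]
    refine ENNReal.ofReal_le_ofReal (Real.sqrt_le_iff.2 ⟨hε.le, ?_⟩)
    rw [← covariance_self (memLp_of_mem_span hW (wienerSum_mem_span _ _ _)).aemeasurable,
      covariance_wienerSum hW, min_self]
    refine riemannSum_le (by positivity) _ (fun k hk => ?_) t.2 (by exact_mod_cast ht)
    have hx := dyadic_mem_Icc hk
    obtain ⟨h1, h2⟩ := floor_dyadic_close hx m
    rw [← sq, ← sq_abs]
    exact pow_le_pow_left₀ (abs_nonneg _) (hm _ hx _ h1 h2) 2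
  have hcauchy : CauchySeq fun m => (hmem m).toLp (wienerSum W f m t) := by
    refine Metric.cauchySeq_iff'.2 fun ε hε => ?_
    obtain ⟨N, hN⟩ := eventually_atTop.1 (hclose (ε / 2) (half_pos hε))
    refine ⟨N, fun n hn => ?_⟩
    rw [Lp.dist_def, eLpNorm_congr_ae ((hmem n).coeFn_toLp.sub (hmem N).coeFn_toLp)]
    exact (ENNReal.toReal_le_of_le_ofReal (half_pos hε).le (hN N le_rfl n hn)).trans_lt
      (half_lt_self hε)
  obtain ⟨I, hI⟩ := cauchySeq_tendsto_of_complete hcauchy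
  refine ⟨I, (Lp.stronglyMeasurable I).measurable, ?_⟩
  rw [Lp.tendsto_Lp_iff_tendsto_eLpNorm'] at hI
  refine hI.congr fun m => eLpNorm_congr_ae ?_
  filter_upwards [(hmem m).coeFn_toLp] with ω hω
  simp [hω]

lemma isWienerIntegral_wienerIntegral (hW : IsPreBrownianReal W P) {f : ℝ → ℝ}
    (hf : ContinuousOn f (Set.Icc 0 1)) {t : ℝ≥0} (ht : t ≤ 1) :
    IsWienerIntegral P W f t (wienerIntegral P W f t) := by
  have h := exists_isWienerIntegral hW hf ht
  rw [wienerIntegral, dif_pos h]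
  exact h.choose_spec

end Existence

/-! ### Mean-square limits of characteristic functions. -/

section MeanSquare

variable {Ω : Type*} [MeasurableSpace Ω] {P : Measure Ω}

/-- A sequence of random variables converges to `0` in mean square. -/
def IsL2Null (P : Measure Ω) (D : ℕ → Ω → ℝ) : Prop :=
  (∀ m, AEStronglyMeasurable (D m) P) ∧ Tendsto (fun m => eLpNorm (D m) 2 P) atTop (𝓝 0)

lemma IsL2Null.add {D E : ℕ → Ω → ℝ} (hD : IsL2Null P D) (hE : IsL2Null P E) :
    IsL2Null P (D + E) := by
  refine ⟨fun m => (hD.1 m).add (hE.1 m), ?_⟩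
  refine tendsto_of_tendsto_of_tendsto_of_le_of_le tendsto_const_nhds
    (by simpa using hD.2.add hE.2) (fun m => zero_le) fun m => ?_
  exact eLpNorm_add_le (hD.1 m) (hE.1 m) (by norm_num)

lemma IsL2Null.const_smul {D : ℕ → Ω → ℝ} (c : ℝ) (hD : IsL2Null P D) :
    IsL2Null P (c • D) := by
  refine ⟨fun m => (hD.1 m).const_smul c, ?_⟩
  have h : Tendsto (fun m => ‖c‖ₑ * eLpNorm (D m) 2 P) atTop (𝓝 0) := by
    simpa using ENNReal.Tendsto.const_mul hD.2 (Or.inr enorm_ne_top)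
  exact h.congr fun m => (eLpNorm_const_smul c (D m) 2 P).symm

lemma IsL2Null.sub {D E : ℕ → Ω → ℝ} (hD : IsL2Null P D) (hE : IsL2Null P E) :
    IsL2Null P (D - E) := by
  simpa [sub_eq_add_neg] using hD.add (hE.const_smul (-1))

lemma IsL2Null.sum {ι : Type*} (s : Finset ι) {D : ι → ℕ → Ω → ℝ} (hD : ∀ i, IsL2Null P (D i)) :
    IsL2Null P (∑ i ∈ s, D i) := by
  classical
  induction s using Finset.induction_on with
  | empty => exact ⟨fun m => aestronglyMeasurable_const, by simp⟩
  | insert i s hi ih => rw [Finset.sum_insert hi]; exact (hD i).add ih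

/-- Characteristic functions pass to limits in mean square. -/
lemma charFun_eq_of_isL2Null [IsProbabilityMeasure P] {T : ℕ → Ω → ℝ} {S : Ω → ℝ}
    (hT : ∀ m, AEMeasurable (T m) P) (hS : AEMeasurable S P) (h : IsL2Null P fun m => T m - S)
    {c : ℂ} (hc : Tendsto (fun m => charFun (P.map (T m)) 1) atTop (𝓝 c)) :
    charFun (P.map S) 1 = c := by
  -- Mean-square convergence gives almost sure convergence along a subsequence; dominated
  -- convergence applies because the integrands have modulus one.
  obtain ⟨ns, hns, hae⟩ := (tendstoInMeasure_of_tendsto_eLpNorm (by norm_num)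
    (fun m => (hT m).aestronglyMeasurable) hS.aestronglyMeasurable h.2).exists_seq_tendsto_ae
  refine tendsto_nhds_unique ?_ (hc.comp hns.tendsto_atTop)
  have key (R : Ω → ℝ) (hR : AEMeasurable R P) :
      charFun (P.map R) 1 = ∫ ω, Complex.exp (R ω * Complex.I) ∂P := by
    rw [charFun_apply, integral_map hR (by fun_prop)]
    simp
  rw [key S hS]
  simp only [Function.comp_def, key _ (hT _)]
  refine tendsto_integral_of_dominated_convergence (fun _ => 1) (fun m => ?_)
    (integrable_const _) (fun m => ?_) ?_
  · exact (by fun_prop : Continuous fun x : ℝ => Complex.exp (x * Complex.I))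
      |>.measurable.comp_aemeasurable
      (hT _) |>.aestronglyMeasurable
  · exact Eventually.of_forall fun ω => by rw [Complex.norm_exp_ofReal_mul_I]
  · filter_upwards [hae] with ω hω
    exact ((by fun_prop : Continuous fun x : ℝ => Complex.exp (x * Complex.I)).tendsto _).comp hω

end MeanSquare

/-! ### The Itô isometry for combinations of increments. -/

section Increments

variable {Ω : Type*} {W : ℝ≥0 → Ω → ℝ}

/-- A linear combination of increments of stochastic integrals of step functions. -/
noncomputable def incrementSum {n : ℕ} (W : ℝ≥0 → Ω → ℝ) (f : Fin n → ℝ → ℝ) (t : ℕ → ℝ≥0)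
    (m : ℕ) : Ω → ℝ :=
  ∑ i : Fin n, (wienerSum W (f i) m (t (i + 1)) - wienerSum W (f i) m (t i))

lemma incrementSum_mem_span {n : ℕ} (f : Fin n → ℝ → ℝ) (t : ℕ → ℝ≥0) (m : ℕ) :
    incrementSum W f t m ∈ Submodule.span ℝ (Set.range W) :=
  Submodule.sum_mem _ fun _ _ =>
    Submodule.sub_mem _ (wienerSum_mem_span _ _ _) (wienerSum_mem_span _ _ _)

variable [MeasurableSpace Ω] {P : Measure Ω}

/-- Each increment may carry its own integrand. The cross terms vanish because the time intervals do
not overlap, and the diagonal terms are differences of Riemann sums of `f i ^ 2`. -/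
lemma tendsto_variance_incrementSum (hW : IsPreBrownianReal W P) {n : ℕ} {f : Fin n → ℝ → ℝ}
    (hf : ∀ i, ContinuousOn (f i) (Set.Icc 0 1)) {t : ℕ → ℝ≥0} (ht : Monotone t)
    (ht1 : ∀ i ≤ n, t i ≤ 1) :
    Tendsto (fun m => Var[incrementSum W f t m; P]) atTop
      (𝓝 (∑ i : Fin n, ∫ x in (t i : ℝ)..(t (i + 1)), f i x ^ 2)) := by
  have := hW.isGaussianProcess.isProbabilityMeasure
  have hmem (f : ℝ → ℝ) (m : ℕ) (t : ℝ≥0) : MemLp (wienerSum W f m t) 2 P :=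
    memLp_of_mem_span hW (wienerSum_mem_span f m t)
  have hvar (m : ℕ) : Var[incrementSum W f t m; P] = ∑ i : Fin n,
      (riemannSum (fun x => f i x ^ 2) m (t (i + 1)) - riemannSum (fun x => f i x ^ 2) m (t i)) := by
    rw [← covariance_self (memLp_of_mem_span hW (incrementSum_mem_span f t m)).aemeasurable,
      incrementSum, covariance_sum_sum (fun i => (hmem _ _ _).sub (hmem _ _ _))
        (fun i => (hmem _ _ _).sub (hmem _ _ _))]
    refine Finset.sum_congr rfl fun i _ => ?_
    rw [Finset.sum_eq_single i]
    · rw [covariance_sub_sub (hmem _ _ _) (hmem _ _ _) (hmem _ _ _) (hmem _ _ _)]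
      simp only [covariance_wienerSum hW, ← sq]
      have : (t i : ℝ) ≤ t (i + 1) := by exact_mod_cast ht (Nat.le_succ _)
      rw [min_self, min_self, min_eq_left this, min_eq_right this]
      ring
    · intro j _ hj
      rw [covariance_sub_sub (hmem _ _ _) (hmem _ _ _) (hmem _ _ _) (hmem _ _ _)]
      simp only [covariance_wienerSum hW]
      have hle (k l : ℕ) (h : k ≤ l) : (t k : ℝ) ≤ t l := by exact_mod_cast ht h
      rcases lt_or_gt_of_ne hj with h | h
      · have h' : (j : ℕ) < i := h
        rw [min_eq_right (hle _ _ (by omega)), min_eq_right (hle _ _ (by omega)),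
          min_eq_right (hle _ _ (by omega)), min_eq_right (hle _ _ (by omega))]
        ring
      · have h' : (i : ℕ) < j := h
        rw [min_eq_left (hle _ _ (by omega)), min_eq_left (hle _ _ (by omega)),
          min_eq_left (hle _ _ (by omega)), min_eq_left (hle _ _ (by omega))]
        ring
    · simp
  simp only [hvar]
  refine tendsto_finsetSum _ fun i _ => ?_
  have hc : ContinuousOn (fun x => f i x ^ 2) (Set.Icc 0 1) := (hf i).pow 2
  have h1 : (t (i + 1) : ℝ) ≤ 1 := by exact_mod_cast ht1 (i + 1) i.2
  have h0 : (t i : ℝ) ≤ 1 := by exact_mod_cast ht1 i i.2.le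
  have hint (r : ℝ≥0) (hr : (r : ℝ) ≤ 1) :
      IntervalIntegrable (fun x => f i x ^ 2) volume 0 r := by
    refine (hc.mono ?_).intervalIntegrable
    rw [Set.uIcc_of_le (NNReal.coe_nonneg r)]
    exact Set.Icc_subset_Icc le_rfl hr
  rw [← intervalIntegral.integral_interval_sub_left (hint _ h1) (hint _ h0)]
  exact (tendsto_riemannSum hc (t (i + 1)).2 h1).sub (tendsto_riemannSum hc (t i).2 h0)

end Increments

/-! ### Planar Gaussian laws as linear images of a standard pair. -/

section PairMap

/-- The linear map `(ξ, η) ↦ (x ξ, y ξ + z η)` of the plane. -/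
noncomputable def pairMap (x y z : ℝ) : ℝ × ℝ →L[ℝ] ℝ × ℝ :=
  (x • ContinuousLinearMap.fst ℝ ℝ ℝ).prod
    (y • ContinuousLinearMap.fst ℝ ℝ ℝ + z • ContinuousLinearMap.snd ℝ ℝ ℝ)

@[simp]
lemma pairMap_apply (x y z : ℝ) (p : ℝ × ℝ) : pairMap x y z p = (x * p.1, y * p.1 + z * p.2) := by
  simp [pairMap]

/-- The standard Gaussian measure on the plane. -/
noncomputable abbrev stdPair : Measure (ℝ × ℝ) := (gaussianReal 0 1).prod (gaussianReal 0 1)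

instance (x y z : ℝ) : IsProbabilityMeasure (stdPair.map (pairMap x y z)) :=
  Measure.isProbabilityMeasure_map (by fun_prop)

lemma charFunDual_gaussianReal_std (L : StrongDual ℝ ℝ) :
    charFunDual (gaussianReal 0 1) L = Complex.exp (-((L 1 ^ 2 : ℝ) : ℂ) / 2) := by
  have h : charFunDual (gaussianReal 0 1) L = charFun (gaussianReal 0 1) (L 1) := by
    rw [charFunDual_apply, charFun_apply]
    congr with x
    have : L x = x * L 1 := by simpa using L.map_smul x 1
    simp [this, mul_comm]
  rw [h, charFun_gaussianReal]
  congr 1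
  push_cast
  ring

/-- Expanding the exponent shows that the law depends on `x, y, z` only through `x²`, `xy` and `y² +
z²`, the entries of the covariance matrix. -/
lemma charFunDual_map_pairMap (x y z : ℝ) (L : StrongDual ℝ (ℝ × ℝ)) :
    charFunDual (stdPair.map (pairMap x y z)) L =
      Complex.exp (-(((L (1, 0) * x + L (0, 1) * y) ^ 2 + (L (0, 1) * z) ^ 2 : ℝ) : ℂ) / 2) := by
  have hL (p : ℝ × ℝ) : L p = p.1 * L (1, 0) + p.2 * L (0, 1) := by
    rw [← smul_eq_mul, ← smul_eq_mul, ← L.map_smul, ← L.map_smul, ← L.map_add]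
    simp
  rw [charFunDual_map, charFunDual_prod, charFunDual_gaussianReal_std,
    charFunDual_gaussianReal_std, ← Complex.exp_add]
  congr 1
  simp only [ContinuousLinearMap.comp_apply, ContinuousLinearMap.inl_apply,
    ContinuousLinearMap.inr_apply, pairMap_apply]
  rw [hL (x * 1, y * 1 + z * 0), hL (x * 0, y * 0 + z * 1)]
  push_cast
  ring

end PairMap

/-! ### Initial values and increments of the process. -/

section Observation

variable {Ω : Type*} [MeasurableSpace Ω] {P : Measure Ω} {W W' : ℝ≥0 → Ω → ℝ} {X₀ Y₀ : Ω → ℝ}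

lemma isL2Null_wienerIntegral (hW : IsPreBrownianReal W P) {f : ℝ → ℝ}
    (hf : ContinuousOn f (Set.Icc 0 1)) {t : ℝ≥0} (ht : t ≤ 1) :
    IsL2Null P fun m => wienerSum W f m t - wienerIntegral P W f t := by
  have h := isWienerIntegral_wienerIntegral hW hf ht
  exact ⟨fun m => (memLp_of_mem_span hW (wienerSum_mem_span f m t)).aestronglyMeasurable.sub
    h.1.aestronglyMeasurable, h.2⟩

lemma measurable_wienerIntegral (P : Measure Ω) (W : ℝ≥0 → Ω → ℝ) (f : ℝ → ℝ) (t : ℝ≥0) :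
    Measurable (wienerIntegral P W f t) := by
  unfold wienerIntegral
  split_ifs with h
  · exact h.choose_spec.1
  · exact measurable_const

/-- The value at time `t` of the process with coefficients `b`, `σ`, `τ`. -/
noncomputable def processValue (P : Measure Ω) (W W' : ℝ≥0 → Ω → ℝ) (X₀ Y₀ : Ω → ℝ)
    (b σ τ : ℝ → ℝ) (t : ℝ≥0) (ω : Ω) : ℝ × ℝ :=
  (X₀ ω + wienerIntegral P W σ t ω,
    Y₀ ω + wienerIntegral P W (fun s => b s * σ s) t ω + wienerIntegral P W' τ t ω)

lemma measurable_processValue (hX : Measurable X₀) (hY : Measurable Y₀) (b σ τ : ℝ → ℝ)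
    (t : ℝ≥0) : Measurable (processValue P W W' X₀ Y₀ b σ τ t) :=
  (hX.add (measurable_wienerIntegral P W σ t)).prodMk
    ((hY.add (measurable_wienerIntegral P W _ t)).add (measurable_wienerIntegral P W' τ t))

/-- The initial value and the increments of the process along a sequence of times. -/
noncomputable def startIncrements (P : Measure Ω) (W W' : ℝ≥0 → Ω → ℝ) (X₀ Y₀ : Ω → ℝ)
    (b σ τ : ℝ → ℝ) (n : ℕ) (t : ℕ → ℝ≥0) (ω : Ω) : (ℝ × ℝ) × (Fin n → ℝ × ℝ) :=
  (processValue P W W' X₀ Y₀ b σ τ (t 0) ω, fun i =>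
    processValue P W W' X₀ Y₀ b σ τ (t (i + 1)) ω - processValue P W W' X₀ Y₀ b σ τ (t i) ω)

lemma measurable_startIncrements (hX : Measurable X₀) (hY : Measurable Y₀) (b σ τ : ℝ → ℝ)
    (n : ℕ) (t : ℕ → ℝ≥0) : Measurable (startIncrements P W W' X₀ Y₀ b σ τ n t) :=
  (measurable_processValue hX hY b σ τ _).prodMk <| measurable_pi_lambda _ fun _ =>
    (measurable_processValue hX hY b σ τ _).sub (measurable_processValue hX hY b σ τ _)

/-- The characteristic function of a linear combination of the initial values and independent
Gaussian variables built from the two Brownian motions. -/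
lemma IsNoise.charFun_add [IsProbabilityMeasure P] (h : IsNoise P W W' X₀ Y₀) (u v : ℝ)
    {Z Z' : Ω → ℝ} (hZ : Z ∈ Submodule.span ℝ (Set.range W))
    (hZ' : Z' ∈ Submodule.span ℝ (Set.range W')) :
    charFun (P.map fun ω => (u * X₀ ω + v * Y₀ ω) + (Z ω + Z' ω)) 1 =
      charFun (P.map fun ω => u * X₀ ω + v * Y₀ ω) 1 *
        (Complex.exp (-(Var[Z; P] : ℂ) / 2) * Complex.exp (-(Var[Z'; P] : ℂ) / 2)) := by
  have hW := h.brownian_fst.toIsPreBrownianReal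
  have hW' := h.brownian_snd.toIsPreBrownianReal
  have mZ := (memLp_of_mem_span hW hZ).aemeasurable
  have mZ' := (memLp_of_mem_span hW' hZ').aemeasurable
  rw [← charFun_map_one_of_mem_span hW hZ, ← charFun_map_one_of_mem_span hW' hZ']
  obtain ⟨φ, hφ, rfl⟩ := exists_measurable_of_mem_span hZ
  obtain ⟨φ', hφ', rfl⟩ := exists_measurable_of_mem_span hZ'
  have i1 : IndepFun (fun ω => φ fun t => W t ω) (fun ω => φ' fun t => W' t ω) P :=
    h.indep.comp hφ hφ'
  -- Two layers of independence are used: `W` from `W'`, and the initial values from the pair of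
  -- both.
  have i2 : IndepFun (fun ω => u * X₀ ω + v * Y₀ ω)
      (fun ω => φ (fun t => W t ω) + φ' fun t => W' t ω) P := by
    have m1 : Measurable fun p : ℝ × ℝ => u * p.1 + v * p.2 := by fun_prop
    have m2 : Measurable fun w : ℝ≥0 → ℝ × ℝ =>
        φ (fun t => (w t).1) + φ' fun t => (w t).2 := by
      refine (hφ.comp ?_).add (hφ'.comp ?_) <;> fun_prop
    exact h.indep_init.comp m1 m2
  have m0 : AEMeasurable (fun ω => u * X₀ ω + v * Y₀ ω) P :=
    ((h.measurable_init_fst.const_mul u).add (h.measurable_init_snd.const_mul v)).aemeasurable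
  refine (congrFun (i2.charFun_map_fun_add_eq_mul m0 (by exact mZ.add mZ')) 1).trans ?_
  rw [Pi.mul_apply, i1.charFun_map_fun_add_eq_mul mZ mZ', Pi.mul_apply]

end Observation

/-! ### The joint law of the initial value and the increments. -/

section Law

variable {Ω : Type*} [MeasurableSpace Ω] {P : Measure Ω} {W W' : ℝ≥0 → Ω → ℝ} {X₀ Y₀ : Ω → ℝ}

lemma strongDual_pair_apply (L : StrongDual ℝ (ℝ × ℝ)) (p : ℝ × ℝ) :
    L p = L (1, 0) * p.1 + L (0, 1) * p.2 := by
  rw [mul_comm, mul_comm (L (0, 1)), ← smul_eq_mul, ← smul_eq_mul, ← L.map_smul, ← L.map_smul,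
    ← L.map_add]
  simp

/-- The initial values and the increments of the process are independent, and the increments
are centred Gaussian vectors, described by their covariance matrices. -/
lemma map_startIncrements [IsProbabilityMeasure P] (h : IsNoise P W W' X₀ Y₀) {b σ τ : ℝ → ℝ}
    (hb : ContinuousOn b (Set.Icc 0 1)) (hσ : ContinuousOn σ (Set.Icc 0 1))
    (hτ : ContinuousOn τ (Set.Icc 0 1)) {n : ℕ} {t : ℕ → ℝ≥0} (ht : Monotone t) (ht0 : t 0 = 0)
    (ht1 : ∀ i ≤ n, t i ≤ 1) {x y z : Fin n → ℝ}
    (hx : ∀ i : Fin n, x i ^ 2 = ∫ s in (t i : ℝ)..(t (i + 1)), σ s ^ 2)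
    (hxy : ∀ i : Fin n, x i * y i = ∫ s in (t i : ℝ)..(t (i + 1)), b s * σ s ^ 2)
    (hyz : ∀ i : Fin n, y i ^ 2 + z i ^ 2 =
      ∫ s in (t i : ℝ)..(t (i + 1)), (b s ^ 2 * σ s ^ 2 + τ s ^ 2)) :
    P.map (startIncrements P W W' X₀ Y₀ b σ τ n t) =
      (P.map fun ω => (X₀ ω, Y₀ ω)).prod
        (Measure.pi fun i => stdPair.map (pairMap (x i) (y i) (z i))) := by
  have hW := h.brownian_fst.toIsPreBrownianReal
  have hW' := h.brownian_snd.toIsPreBrownianReal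
  have mX := h.measurable_init_fst
  have mY := h.measurable_init_snd
  have mD := measurable_startIncrements (P := P) (W := W) (W' := W') mX mY b σ τ n t
  have : IsProbabilityMeasure (P.map fun ω => (X₀ ω, Y₀ ω)) :=
    Measure.isProbabilityMeasure_map (mX.prodMk mY).aemeasurable
  have : IsProbabilityMeasure (P.map (startIncrements P W W' X₀ Y₀ b σ τ n t)) :=
    Measure.isProbabilityMeasure_map mD.aemeasurable
  refine Measure.ext_of_charFunDual (funext fun L => ?_)
  set L₁ : StrongDual ℝ (ℝ × ℝ) := L.comp (.inl ℝ _ _) with hL₁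
  set L₂ : Fin n → StrongDual ℝ (ℝ × ℝ) :=
    fun i => (L.comp (.inr ℝ _ _)).comp (.single ℝ (fun _ => ℝ × ℝ) i) with hL₂
  set u := L₁ (1, 0)
  set v := L₁ (0, 1)
  set p : Fin n → ℝ := fun i => L₂ i (1, 0) with hp
  set q : Fin n → ℝ := fun i => L₂ i (0, 1) with hq
  have hL (w : (ℝ × ℝ) × (Fin n → ℝ × ℝ)) :
      L w = u * w.1.1 + v * w.1.2 + ∑ i, (p i * (w.2 i).1 + q i * (w.2 i).2) := by
    rw [← L.comp_inl_add_comp_inr, ← strongDual_pair_apply L₁]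
    congr 1
    rw [← (L.comp (.inr ℝ _ _)).sum_comp_single]
    exact Finset.sum_congr rfl fun i _ => strongDual_pair_apply (L₂ i) _
  -- The functional `L` of the data is the initial part plus one integral against `W` and one
  -- against `W'` on each interval; `f i` and `f' i` are the two integrands.
  set f : Fin n → ℝ → ℝ := fun i s => p i * σ s + q i * (b s * σ s) with hf
  set f' : Fin n → ℝ → ℝ := fun i s => q i * τ s with hf'
  have hfc (i : Fin n) : ContinuousOn (f i) (Set.Icc 0 1) := by fun_prop
  have hfc' (i : Fin n) : ContinuousOn (f' i) (Set.Icc 0 1) := by fun_prop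
  have m₀ : Measurable fun ω => u * X₀ ω + v * Y₀ ω := (mX.const_mul u).add (mY.const_mul v)
  rw [charFunDual_prod, charFunDual_pi, charFunDual_eq_charFun_map_one,
    Measure.map_map L.continuous.measurable mD]
  simp only [charFunDual_map_pairMap]
  refine charFun_eq_of_isL2Null
    (T := fun m ω => (u * X₀ ω + v * Y₀ ω) + (incrementSum W f t m ω + incrementSum W' f' t m ω))
    (fun m => ?_) ?_ ?_ ?_
  · exact m₀.aemeasurable.add
      ((memLp_of_mem_span hW (incrementSum_mem_span f t m)).aemeasurable.add
        (memLp_of_mem_span hW' (incrementSum_mem_span f' t m)).aemeasurable)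
  · exact (L.continuous.measurable.comp mD).aemeasurable
  · have ht1' (i : Fin n) : t (i + 1) ≤ 1 := ht1 _ i.2
    have ht1'' (i : Fin n) : t i ≤ 1 := ht1 _ i.2.le
    have nA {t : ℝ≥0} (ht : t ≤ 1) := isL2Null_wienerIntegral hW hσ ht
    have nB {t : ℝ≥0} (ht : t ≤ 1) := isL2Null_wienerIntegral hW (hb.mul hσ) ht
    have nC {t : ℝ≥0} (ht : t ≤ 1) := isL2Null_wienerIntegral hW' hτ ht
    -- The chosen versions of the integrals at time `0` vanish only almost surely, so the starting
    -- value contributes null sequences of its own.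
    have hnull := ((nA zero_le_one).const_smul u).add
      ((((nB zero_le_one).add (nC zero_le_one)).const_smul v).add
        (IsL2Null.sum Finset.univ fun i : Fin n =>
          (((nA (ht1' i)).sub (nA (ht1'' i))).const_smul (p i)).add
            ((((nB (ht1' i)).sub (nB (ht1'' i))).add
              ((nC (ht1' i)).sub (nC (ht1'' i)))).const_smul (q i))))
    convert hnull using 1
    ext m ω
    simp only [Pi.add_apply, Pi.sub_apply, Pi.smul_apply, Finset.sum_apply, smul_eq_mul,
      wienerSum_time_zero, Pi.zero_apply, Function.comp_apply, hL, incrementSum,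
      startIncrements, processValue, ht0, Prod.fst_sub, Prod.snd_sub]
    have e : ∑ i : Fin n, (wienerSum W (f i) m (t (i + 1)) ω - wienerSum W (f i) m (t i) ω) +
        ∑ i : Fin n, (wienerSum W' (f' i) m (t (i + 1)) ω - wienerSum W' (f' i) m (t i) ω) =
        ∑ i : Fin n, (p i * (wienerSum W σ m (t (i + 1)) ω - wienerSum W σ m (t i) ω) + q i *
          ((wienerSum W (fun s => b s * σ s) m (t (i + 1)) ω
              - wienerSum W (fun s => b s * σ s) m (t i) ω)
            + (wienerSum W' τ m (t (i + 1)) ω - wienerSum W' τ m (t i) ω))) := by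
      rw [← Finset.sum_add_distrib]
      refine Finset.sum_congr rfl fun i _ => ?_
      simp only [hf, hf', wienerSum_add, wienerSum_const_mul, Pi.add_apply, Pi.smul_apply,
        smul_eq_mul]
      ring
    rw [e, ← sub_eq_zero]
    simp only [add_sub_add_left_eq_sub, mul_sub, mul_add, Finset.sum_add_distrib,
      Finset.sum_sub_distrib, Pi.mul_def]
    ring
  · have hlim := ((tendsto_variance_incrementSum hW hfc ht ht1).ofReal.neg.div_const (2 : ℂ)).cexp
    have hlim' := ((tendsto_variance_incrementSum hW' hfc' ht ht1).ofReal.neg.div_const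
      (2 : ℂ)).cexp
    have h0 : charFunDual (P.map fun ω => (X₀ ω, Y₀ ω)) L₁ =
        charFun (P.map fun ω => u * X₀ ω + v * Y₀ ω) 1 := by
      rw [charFunDual_eq_charFun_map_one, Measure.map_map L₁.continuous.measurable (mX.prodMk mY)]
      congr 2
      ext ω
      exact strongDual_pair_apply L₁ _
    have := (hlim.mul hlim').const_mul (charFun (P.map fun ω => u * X₀ ω + v * Y₀ ω) 1)
    convert this using 1
    · ext m
      exact h.charFun_add u v (incrementSum_mem_span f t m) (incrementSum_mem_span f' t m)
    · rw [h0, ← Complex.exp_add, ← Complex.exp_sum]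
      congr 3
      rw [← add_div, ← neg_add, ← Complex.ofReal_add, ← Finset.sum_add_distrib,
        ← Finset.sum_div, Finset.sum_neg_distrib, ← Complex.ofReal_sum]
      congr 3
      refine Finset.sum_congr rfl fun i _ => ?_
      have hsub : Set.uIcc (t i : ℝ) (t (i + 1)) ⊆ Set.Icc 0 1 := by
        rw [Set.uIcc_of_le (by exact_mod_cast ht (Nat.le_succ _))]
        exact Set.Icc_subset_Icc (NNReal.coe_nonneg _) (by exact_mod_cast ht1 _ i.2)
      have hi (g : ℝ → ℝ) (hg : ContinuousOn g (Set.Icc 0 1)) :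
          IntervalIntegrable g volume (t i : ℝ) (t (i + 1)) := (hg.mono hsub).intervalIntegrable
      -- The quadratic form sees only the three covariance entries, which the hypotheses express as
      -- integrals.
      calc (p i * x i + q i * y i) ^ 2 + (q i * z i) ^ 2
          = p i ^ 2 * x i ^ 2 + (2 * p i * q i) * (x i * y i)
            + q i ^ 2 * (y i ^ 2 + z i ^ 2) := by ring
        _ = _ := by
          rw [hx, hxy, hyz, ← intervalIntegral.integral_const_mul,
            ← intervalIntegral.integral_const_mul, ← intervalIntegral.integral_const_mul,
            ← intervalIntegral.integral_add, ← intervalIntegral.integral_add,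
            ← intervalIntegral.integral_add]
          · refine intervalIntegral.integral_congr fun s _ => ?_
            simp only [hf, hf']
            ring
          all_goals
            apply hi
            fun_prop

/-- The observations of a process, recovered from its initial value and its increments. -/
noncomputable def partialSums {n : ℕ} (w : (ℝ × ℝ) × (Fin n → ℝ × ℝ)) (k : Fin (n + 1)) : ℝ × ℝ :=
  w.1 + ∑ i : Fin n, if (i : ℕ) < k then w.2 i else 0

lemma measurable_partialSums {n : ℕ} : Measurable (partialSums (n := n)) := by
  refine measurable_pi_lambda _ fun k => measurable_fst.add (Finset.measurable_sum _ fun i _ => ?_)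
  split_ifs
  · exact (measurable_pi_apply i).comp measurable_snd
  · exact measurable_const

lemma partialSums_startIncrements {n : ℕ} (b σ τ : ℝ → ℝ) (t : ℕ → ℝ≥0) (ω : Ω)
    (k : Fin (n + 1)) : partialSums (startIncrements P W W' X₀ Y₀ b σ τ n t ω) k =
      processValue P W W' X₀ Y₀ b σ τ (t k) ω := by
  set o : ℕ → ℝ × ℝ := fun i => processValue P W W' X₀ Y₀ b σ τ (t i) ω
  have h1 : partialSums (startIncrements P W W' X₀ Y₀ b σ τ n t ω) k =
      o 0 + ∑ i : Fin n, if (i : ℕ) < k then o (i + 1) - o i else 0 := rfl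
  rw [h1, Fin.sum_univ_eq_sum_range (fun i => if i < (k : ℕ) then o (i + 1) - o i else 0) n,
    ← Finset.sum_filter]
  have h2 : (Finset.range n).filter (· < (k : ℕ)) = Finset.range k := by
    ext i
    simp only [Finset.mem_filter, Finset.mem_range]
    omega
  rw [h2, Finset.sum_range_sub]
  simp [o]

/-- The law of the observations at the times `i / n` in terms of their Gaussian increments. -/
lemma pathLaw_observe [IsProbabilityMeasure P] (h : IsNoise P W W' X₀ Y₀) {b σ τ : ℝ → ℝ}
    (hb : ContinuousOn b (Set.Icc 0 1)) (hσ : ContinuousOn σ (Set.Icc 0 1))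
    (hτ : ContinuousOn τ (Set.Icc 0 1)) {n : ℕ} {x y z : Fin n → ℝ}
    (hx : ∀ i : Fin n, x i ^ 2 = ∫ s in ((i : ℝ) / n)..(((i : ℝ) + 1) / n), σ s ^ 2)
    (hxy : ∀ i : Fin n, x i * y i = ∫ s in ((i : ℝ) / n)..(((i : ℝ) + 1) / n), b s * σ s ^ 2)
    (hyz : ∀ i : Fin n, y i ^ 2 + z i ^ 2 =
      ∫ s in ((i : ℝ) / n)..(((i : ℝ) + 1) / n), (b s ^ 2 * σ s ^ 2 + τ s ^ 2))
    {A : Set (Fin (n + 1) → ℝ × ℝ)} (hA : MeasurableSet A) :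
    pathLaw P W W' X₀ Y₀ b σ τ {w | observe n w ∈ A} =
      (P.map fun ω => (X₀ ω, Y₀ ω)).prod
        (Measure.pi fun i => stdPair.map (pairMap (x i) (y i) (z i))) (partialSums ⁻¹' A) := by
  have mX := h.measurable_init_fst
  have mY := h.measurable_init_snd
  set t : ℕ → ℝ≥0 := fun i => (i : ℝ≥0) / n with ht
  have hmono : Monotone t := fun i j hij => by
    simp only [ht]
    gcongr
  have ht1 (i : ℕ) (hi : i ≤ n) : t i ≤ 1 :=
    div_le_one_of_le₀ (by exact_mod_cast hi) zero_le
  have hlaw := map_startIncrements h hb hσ hτ (n := n) hmono (by simp [ht]) ht1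
    (x := x) (y := y) (z := z) (by simpa [ht] using hx) (by simpa [ht] using hxy)
    (by simpa [ht] using hyz)
  rw [← hlaw, Measure.map_apply (measurable_startIncrements mX mY b σ τ n t)
    (measurable_partialSums hA), pathLaw, Measure.map_apply]
  · congr 1
    ext ω
    simp only [Set.mem_preimage, Set.mem_ofPred_eq]
    have e : partialSums (startIncrements P W W' X₀ Y₀ b σ τ n t ω) =
        observe n fun s => processValue P W W' X₀ Y₀ b σ τ (unitInterval.toNNReal s) ω := by
      ext1 k
      rw [partialSums_startIncrements, observe]
      congr 1
    rw [e]
    rfl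
  · exact measurable_pi_lambda _ fun s => measurable_processValue mX mY b σ τ _
  · exact (measurable_pi_lambda _ fun k => measurable_pi_apply _) hA

end Law

/-! ### Densities of product measures. -/

section ProductDensity

variable {ι : Type*} [Fintype ι] {E : ι → Type*} [∀ i, MeasurableSpace (E i)]

lemma lintegral_pi_prod (μ : ∀ i, Measure (E i)) [∀ i, IsProbabilityMeasure (μ i)]
    {f : ∀ i, E i → ℝ≥0∞} (hf : ∀ i, Measurable (f i)) :
    ∫⁻ x, ∏ i, f i (x i) ∂(Measure.pi μ) = ∏ i, ∫⁻ x, f i x ∂(μ i) := by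
  have hind : iIndepFun (fun i (x : ∀ i, E i) => f i (x i)) (Measure.pi μ) :=
    iIndepFun_pi (X := f) fun i => (hf i).aemeasurable
  have := lintegral_prod_eq_prod_lintegral_of_indepFun Finset.univ _ hind
    fun i => (hf i).comp (measurable_pi_apply i)
  rw [this]
  refine Finset.prod_congr rfl fun i _ => ?_
  exact (measurePreserving_eval μ i).lintegral_comp (hf i)

lemma pi_withDensity (μ : ∀ i, Measure (E i)) [∀ i, IsProbabilityMeasure (μ i)]
    {f : ∀ i, E i → ℝ≥0∞} (hf : ∀ i, Measurable (f i))
    (hfin : ∀ i, IsProbabilityMeasure ((μ i).withDensity (f i))) :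
    Measure.pi (fun i => (μ i).withDensity (f i)) =
      (Measure.pi μ).withDensity fun x => ∏ i, f i (x i) := by
  refine Measure.pi_eq fun s hs => ?_
  rw [withDensity_apply _ (MeasurableSet.univ_pi hs),
    ← lintegral_indicator (MeasurableSet.univ_pi hs)]
  have h (x : ∀ i, E i) : (Set.univ.pi s).indicator (fun x => ∏ i, f i (x i)) x =
      ∏ i, (s i).indicator (f i) (x i) := by
    classical
    by_cases hx : x ∈ Set.univ.pi s
    · rw [Set.indicator_of_mem hx]
      exact Finset.prod_congr rfl fun i _ => (Set.indicator_of_mem (hx i trivial) _).symm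
    · rw [Set.indicator_of_notMem hx]
      simp only [Set.mem_pi, Set.mem_univ, true_implies, not_forall] at hx
      obtain ⟨i, hi⟩ := hx
      exact (Finset.prod_eq_zero (Finset.mem_univ i) (Set.indicator_of_notMem hi _)).symm
  simp only [h]
  rw [lintegral_pi_prod μ fun i => (hf i).indicator (hs i)]
  refine Finset.prod_congr rfl fun i _ => ?_
  rw [withDensity_apply _ (hs i), lintegral_indicator (hs i)]

end ProductDensity

/-! ### Likelihood ratios for a regression coefficient. -/

section Shear

lemma gaussianReal_eq_withDensity (c : ℝ) :
    gaussianReal c 1 = (gaussianReal 0 1).withDensity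
      fun x => ENNReal.ofReal (Real.exp (c * x - c ^ 2 / 2)) := by
  rw [gaussianReal_of_var_ne_zero _ one_ne_zero, gaussianReal_of_var_ne_zero _ one_ne_zero,
    ← withDensity_mul _ (measurable_gaussianPDF _ _) (by fun_prop)]
  congr 1
  ext x
  rw [Pi.mul_apply, gaussianPDF, gaussianPDF, ← ENNReal.ofReal_mul (gaussianPDFReal_nonneg _ _ _),
    gaussianPDFReal, gaussianPDFReal, mul_assoc _ (Real.exp _) (Real.exp _), ← Real.exp_add]
  congr 3
  simp
  ring

lemma lintegral_exp_gaussianReal (c : ℝ) :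
    ∫⁻ x, ENNReal.ofReal (Real.exp (c * x - c ^ 2 / 2)) ∂(gaussianReal 0 1) = 1 := by
  rw [← setLIntegral_univ, ← withDensity_apply _ MeasurableSet.univ, ← gaussianReal_eq_withDensity,
    measure_univ]

/-- The density of the law of `(ξ, η + l ξ)` with respect to the law of `(ξ, η)`. -/
noncomputable def shearDensity (l : ℝ) (p : ℝ × ℝ) : ℝ :=
  Real.exp (l * p.1 * p.2 - (l * p.1) ^ 2 / 2)

@[fun_prop]
lemma measurable_shearDensity (l : ℝ) : Measurable (shearDensity l) := by
  unfold shearDensity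
  fun_prop

lemma shearDensity_nonneg (l : ℝ) (p : ℝ × ℝ) : 0 ≤ shearDensity l p := (Real.exp_pos _).le

/-- Given the first coordinate `x`, the second one is normal with mean `l * x`, so the density is
the likelihood ratio of a one-dimensional shift by `l * x`. -/
lemma map_shear (l : ℝ) :
    stdPair.map (pairMap 1 l 1) =
      stdPair.withDensity fun p => ENNReal.ofReal (shearDensity l p) := by
  refine Measure.ext_of_lintegral _ fun φ hφ => ?_
  have hm : Measurable fun p : ℝ × ℝ => ENNReal.ofReal (shearDensity l p) := by fun_prop
  rw [lintegral_map hφ (by fun_prop), lintegral_withDensity_eq_lintegral_mul _ hm hφ,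
    lintegral_prod _ (by fun_prop), lintegral_prod _ (by fun_prop)]
  refine lintegral_congr fun x => ?_
  have h1 : ∫⁻ y, φ (pairMap 1 l 1 (x, y)) ∂(gaussianReal 0 1) =
      ∫⁻ y, φ (x, y) ∂(gaussianReal (l * x) 1) := by
    have := gaussianReal_map_const_add (μ := 0) (v := 1) (l * x)
    rw [zero_add] at this
    rw [← this, lintegral_map (by fun_prop) (by fun_prop)]
    simp
  rw [h1, gaussianReal_eq_withDensity, lintegral_withDensity_eq_lintegral_mul _ (by fun_prop)
    (by fun_prop)]
  rfl

/-- This bounds `1 / (1 - x)` by `exp (x + x²)`, to be applied with `x = 2c` to the Gaussian moment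
below. -/
lemma one_le_mul_exp_quadratic {x : ℝ} (h1 : -(1 / 2) ≤ x) (h2 : x ≤ 1 / 2) :
    1 ≤ (1 - x) * Real.exp (x + x ^ 2) := by
  rcases le_total x 0 with hx | hx
  · have := Real.add_one_le_exp (x + x ^ 2)
    nlinarith [mul_nonneg (neg_nonneg.2 hx) (sq_nonneg x)]
  · have h3 := Real.quadratic_le_exp_of_nonneg (x := x + x ^ 2) (by positivity)
    have h4 : 1 ≤ (1 - x) * (1 + (x + x ^ 2) + (x + x ^ 2) ^ 2 / 2) := by
      have : 0 ≤ (1 - x ^ 2) * (1 + x) - 2 * x := by nlinarith [mul_nonneg hx hx]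
      nlinarith [mul_nonneg (sq_nonneg x) this]
    exact h4.trans (mul_le_mul_of_nonneg_left h3 (by linarith))

/-- The integral equals `(1 - 2c)^(-1/2)`; the exponential form of the bound makes it multiply well
over many increments. -/
lemma lintegral_exp_sq_gaussianReal_le {c : ℝ} (h1 : -(1 / 4) ≤ c) (h2 : c ≤ 1 / 4) :
    ∫⁻ x, ENNReal.ofReal (Real.exp (c * x ^ 2)) ∂(gaussianReal 0 1) ≤
      ENNReal.ofReal (Real.exp (c + 2 * c ^ 2)) := by
  have hc : 0 < 1 / 2 - c := by linarith
  have hmul (x : ℝ) : gaussianPDFReal 0 1 x * Real.exp (c * x ^ 2) =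
      (√(2 * Real.pi))⁻¹ * Real.exp (-(1 / 2 - c) * x ^ 2) := by
    rw [gaussianPDFReal, mul_assoc _ (Real.exp _) (Real.exp _), ← Real.exp_add, NNReal.coe_one,
      mul_one, mul_one]
    congr 2
    ring
  rw [gaussianReal_of_var_ne_zero _ one_ne_zero,
    lintegral_withDensity_eq_lintegral_mul _ (measurable_gaussianPDF _ _) (by fun_prop)]
  simp only [Pi.mul_apply, gaussianPDF, ← ENNReal.ofReal_mul (gaussianPDFReal_nonneg _ _ _), hmul]
  rw [← ofReal_integral_eq_lintegral_ofReal ((integrable_exp_neg_mul_sq hc).const_mul _)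
    (Eventually.of_forall fun x => by positivity), integral_const_mul, integral_gaussian]
  refine ENNReal.ofReal_le_ofReal ?_
  rw [← Real.sqrt_inv, ← Real.sqrt_mul (by positivity), Real.sqrt_le_iff]
  refine ⟨(Real.exp_pos _).le, ?_⟩
  have h3 := one_le_mul_exp_quadratic (x := 2 * c) (by linarith) (by linarith)
  have h4 : (2 * Real.pi)⁻¹ * (Real.pi / (1 / 2 - c)) = (1 - 2 * c)⁻¹ := by
    have := Real.pi_pos.ne'
    have : 1 - 2 * c ≠ 0 := by linarith
    field_simp
  rw [h4, ← Real.exp_nat_mul, inv_le_iff_one_le_mul₀ (by linarith)]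
  rw [mul_comm, show ((2 : ℕ) : ℝ) * (c + 2 * c ^ 2) = 2 * c + (2 * c) ^ 2 by push_cast; ring]
  exact h3

/-- The second moments of the densities of sheared Gaussian vectors. -/
lemma lintegral_shearDensity_mul_le {l l' : ℝ} (h1 : -(1 / 4) ≤ l * l') (h2 : l * l' ≤ 1 / 4) :
    ∫⁻ p, ENNReal.ofReal (shearDensity l p * shearDensity l' p) ∂stdPair ≤
      ENNReal.ofReal (Real.exp (l * l' + 2 * (l * l') ^ 2)) := by
  rw [lintegral_prod _ (by fun_prop)]
  refine le_trans (le_of_eq ?_) (lintegral_exp_sq_gaussianReal_le h1 h2)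
  refine lintegral_congr fun x => ?_
  -- Completing the square leaves the density of a shift by `(l + l') * x`, which integrates to one
  -- in `y`, and the factor `exp (l l' x²)`.
  have (y : ℝ) : ENNReal.ofReal (shearDensity l (x, y) * shearDensity l' (x, y)) =
      ENNReal.ofReal (Real.exp (l * l' * x ^ 2)) *
        ENNReal.ofReal (Real.exp (((l + l') * x) * y - ((l + l') * x) ^ 2 / 2)) := by
    rw [← ENNReal.ofReal_mul (Real.exp_pos _).le, shearDensity, shearDensity, ← Real.exp_add,
      ← Real.exp_add]
    congr 2
    ring
  simp only [this]
  rw [lintegral_const_mul _ (by fun_prop), lintegral_exp_gaussianReal, mul_one]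

end Shear

/-! ### The second-moment method for mixtures. -/

section Mixture

variable {E : Type*} [MeasurableSpace E] {Q : Measure E}

/-- A density with second moment at most `1 + c ^ 2` changes probabilities by at most `c`. -/
lemma measureReal_le_setIntegral_add [IsProbabilityMeasure Q] {r : E → ℝ} (hr : Integrable r Q)
    (hr2 : Integrable (fun x => r x ^ 2) Q) (h1 : ∫ x, r x ∂Q = 1) {c : ℝ} (hc : 0 < c)
    (h2 : ∫ x, r x ^ 2 ∂Q ≤ 1 + c ^ 2) (A : Set E) :
    Q.real A ≤ ∫ x in A, r x ∂Q + c := by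
  have hint : Integrable (fun x => (1 - r x) ^ 2) Q := by
    have : (fun x => (1 - r x) ^ 2) = fun x => 1 - 2 * r x + r x ^ 2 := by ext; ring
    rw [this]
    exact ((integrable_const _).sub (hr.const_mul 2)).add hr2
  have hsq : ∫ x, (1 - r x) ^ 2 ∂Q ≤ c ^ 2 := by
    have hi : Integrable (fun x => 1 - 2 * r x) Q := (integrable_const _).sub (hr.const_mul 2)
    have : (fun x => (1 - r x) ^ 2) = fun x => 1 - 2 * r x + r x ^ 2 := by ext; ring
    rw [this, integral_add hi hr2,
      integral_sub (integrable_const _) (hr.const_mul 2), integral_const_mul, h1]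
    simp
    linarith
  -- A weighted arithmetic-geometric mean inequality plays the role of Cauchy-Schwarz; the weight
  -- `c` balances the two terms after integration.
  have hpt (x : E) : 1 - r x ≤ c / 2 + (2 * c)⁻¹ * (1 - r x) ^ 2 := by
    have h : 0 ≤ (2 * c)⁻¹ * ((1 - r x) - c) ^ 2 := by positivity
    have : (2 * c)⁻¹ * ((1 - r x) - c) ^ 2 =
        c / 2 + (2 * c)⁻¹ * (1 - r x) ^ 2 - (1 - r x) := by field_simp; ring
    linarith
  have hset : ∫ x in A, (1 - r x) ∂Q ≤ c := by
    calc ∫ x in A, (1 - r x) ∂Q ≤ ∫ x in A, (c / 2 + (2 * c)⁻¹ * (1 - r x) ^ 2) ∂Q :=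
          integral_mono (((integrable_const _).sub hr).restrict)
            (((integrable_const _).add (hint.const_mul _)).restrict) hpt
      _ ≤ ∫ x, (c / 2 + (2 * c)⁻¹ * (1 - r x) ^ 2) ∂Q :=
          setIntegral_le_integral ((integrable_const _).add (hint.const_mul _))
            (Eventually.of_forall fun x => by simp only [Pi.zero_apply]; positivity)
      _ = c / 2 + (2 * c)⁻¹ * ∫ x, (1 - r x) ^ 2 ∂Q := by
          rw [integral_add (integrable_const _) (hint.const_mul _), integral_const_mul]
          simp
      _ ≤ c / 2 + (2 * c)⁻¹ * c ^ 2 := by gcongr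
      _ = c := by field_simp; ring
  rw [integral_sub (integrable_const _).restrict hr.restrict] at hset
  simp only [integral_const, measureReal_restrict_apply_univ, smul_eq_mul, mul_one] at hset
  linarith

lemma integrable_of_lintegral_ofReal_le {f : E → ℝ} (hf : Measurable f) (h0 : ∀ x, 0 ≤ f x)
    {B : ℝ} (hB : 0 ≤ B) (h : ∫⁻ x, ENNReal.ofReal (f x) ∂Q ≤ ENNReal.ofReal B) :
    Integrable f Q ∧ ∫ x, f x ∂Q ≤ B := by
  have hi : Integrable f Q := (lintegral_ofReal_ne_top_iff_integrable hf.aestronglyMeasurable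
    (Eventually.of_forall h0)).1 (h.trans_lt ENNReal.ofReal_lt_top).ne
  refine ⟨hi, ?_⟩
  rw [← ofReal_integral_eq_lintegral_ofReal hi (Eventually.of_forall h0)] at h
  exact (ENNReal.ofReal_le_ofReal_iff hB).1 h

/-- If a uniform mixture of probability densities has a second moment close to `1`, then no event
has a much larger probability under `Q` than under all components of the mixture. -/
lemma exists_measure_le_withDensity_add [IsProbabilityMeasure Q] {ι : Type*} [Fintype ι]
    [Nonempty ι] {ℓ : ι → E → ℝ}
    (hℓ : ∀ i, Measurable (ℓ i)) (hℓ0 : ∀ i x, 0 ≤ ℓ i x)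
    (h1 : ∀ i, ∫⁻ x, ENNReal.ofReal (ℓ i x) ∂Q = 1) {B : ι → ι → ℝ} (hB0 : ∀ i j, 0 ≤ B i j)
    (hB : ∀ i j, ∫⁻ x, ENNReal.ofReal (ℓ i x * ℓ j x) ∂Q ≤ ENNReal.ofReal (B i j))
    {c : ℝ} (hc : 0 < c) (hsum : ∑ i, ∑ j, B i j ≤ (Fintype.card ι : ℝ) ^ 2 * (1 + c ^ 2))
    {A : Set E} (hA : MeasurableSet A) :
    ∃ i, Q A ≤ Q.withDensity (fun x => ENNReal.ofReal (ℓ i x)) A + ENNReal.ofReal c := by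
  set N : ℝ := (Fintype.card ι : ℝ) with hN
  have hNpos : 0 < N := by simp only [hN]; exact_mod_cast Fintype.card_pos
  have hi (i : ι) : Integrable (ℓ i) Q :=
    (integrable_of_lintegral_ofReal_le (hℓ i) (hℓ0 i) zero_le_one (by simp [h1])).1
  have hint (i : ι) : ∫ x, ℓ i x ∂Q = 1 := by
    rw [integral_eq_lintegral_of_nonneg_ae (Eventually.of_forall (hℓ0 i))
      (hℓ i).aestronglyMeasurable, h1, ENNReal.toReal_one]
  have h2 (i j : ι) : Integrable (fun x => ℓ i x * ℓ j x) Q ∧ ∫ x, ℓ i x * ℓ j x ∂Q ≤ B i j :=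
    integrable_of_lintegral_ofReal_le ((hℓ i).mul (hℓ j))
    (fun x => mul_nonneg (hℓ0 i x) (hℓ0 j x)) (hB0 i j) (hB i j)
  have hreal (i : ι) : (Q.withDensity fun x => ENNReal.ofReal (ℓ i x)) A =
      ENNReal.ofReal (∫ x in A, ℓ i x ∂Q) := by
    rw [withDensity_apply _ hA, ofReal_integral_eq_lintegral_ofReal (hi i).restrict
      (Eventually.of_forall (hℓ0 i))]
  have hsqeq : (fun x => (N⁻¹ * ∑ i, ℓ i x) ^ 2) =
      fun x => (N ^ 2)⁻¹ * ∑ i, ∑ j, ℓ i x * ℓ j x := by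
    ext x
    rw [mul_pow, sq (∑ i, ℓ i x), Finset.sum_mul_sum, inv_pow]
  have hsqi : Integrable (fun x => ∑ i, ∑ j, ℓ i x * ℓ j x) Q :=
    integrable_finsetSum _ fun i _ => integrable_finsetSum _ fun j _ => (h2 i j).1
  have key := measureReal_le_setIntegral_add (Q := Q) (r := fun x => N⁻¹ * ∑ i, ℓ i x)
    ((integrable_finsetSum _ fun i _ => hi i).const_mul _)
    (by rw [hsqeq]; exact hsqi.const_mul _)
    (by
      rw [integral_const_mul, integral_finsetSum _ fun i _ => hi i]
      simp [hint, ← hN, hNpos.ne'])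
    hc
    (by
      rw [hsqeq, integral_const_mul, inv_mul_le_iff₀ (by positivity)]
      refine le_trans ?_ hsum
      rw [integral_finsetSum _ fun i _ => integrable_finsetSum _ fun j _ => (h2 i j).1]
      refine Finset.sum_le_sum fun i _ => ?_
      rw [integral_finsetSum _ fun j _ => (h2 i j).1]
      exact Finset.sum_le_sum fun j _ => (h2 i j).2)
    A
  -- If the bound failed for every component on the same event `A`, averaging would contradict the
  -- bound for the mixture.
  by_contra! hcon
  have hcon' (i : ι) : ∫ x in A, ℓ i x ∂Q + c < Q.real A := by
    have h := hcon i
    rw [hreal, ← ENNReal.ofReal_add (setIntegral_nonneg hA fun x _ => hℓ0 i x) hc.le,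
      ← ENNReal.ofReal_toReal (measure_ne_top Q A)] at h
    exact (ENNReal.ofReal_lt_ofReal_iff_of_nonneg
      (add_nonneg (setIntegral_nonneg hA fun x _ => hℓ0 i x) hc.le)).1 h
  rw [integral_const_mul, integral_finsetSum _ fun i _ => (hi i).restrict] at key
  have hlt : ∑ i : ι, (∫ x in A, ℓ i x ∂Q + c) < ∑ _i : ι, Q.real A :=
    Finset.sum_lt_sum_of_nonempty Finset.univ_nonempty fun i _ => hcon' i
  rw [Finset.sum_add_distrib] at hlt
  simp only [Finset.sum_const, Finset.card_univ, nsmul_eq_mul, ← hN] at hlt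
  have : N * Q.real A ≤ N * (N⁻¹ * ∑ i, ∫ x in A, ℓ i x ∂Q + c) :=
    mul_le_mul_of_nonneg_left key hNpos.le
  rw [mul_add, mul_inv_cancel_left₀ hNpos.ne'] at this
  linarith

end Mixture

/-! ### Random signs on blocks. -/

section Rademacher

/-- The sign encoded by a Boolean. -/
def boolSign (e : Bool) : ℝ := if e then 1 else -1

lemma boolSign_sq (e : Bool) : boolSign e ^ 2 = 1 := by cases e <;> simp [boolSign]

lemma abs_boolSign (e : Bool) : |boolSign e| = 1 := by cases e <;> simp [boolSign]

/-- The sum over all signs factorizes into terms `2 cosh (lam j)`, each at most `2 exp (lam j ^ 2 /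
2)`. The fixed signs `e` drop out because `cosh` is even. -/
lemma sum_exp_boolSign_le {κ : Type*} [Fintype κ] [DecidableEq κ] (e : κ → Bool) (lam : κ → ℝ) :
    ∑ e' : κ → Bool, Real.exp (∑ j, boolSign (e j) * boolSign (e' j) * lam j) ≤
      2 ^ Fintype.card κ * Real.exp ((∑ j, lam j ^ 2) / 2) := by
  simp only [Real.exp_sum]
  rw [← Fintype.prod_sum fun j (e' : Bool) => Real.exp (boolSign (e j) * boolSign e' * lam j),
    Finset.sum_div, Real.exp_sum, ← Finset.card_univ, ← Finset.prod_const,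
    ← Finset.prod_mul_distrib]
  refine Finset.prod_le_prod (fun j _ => Finset.sum_nonneg fun _ _ => (Real.exp_pos _).le)
    fun j _ => ?_
  have h := Real.cosh_le_exp_half_sq (lam j)
  rw [Real.cosh_eq] at h
  rw [Fintype.sum_bool]
  cases e j <;> simp [boolSign] <;> linarith

variable {n : ℕ}

/-- The law of the initial value and of the standardized increments, when the `i`-th increments
have regression coefficient `l i`. -/
noncomputable def shearedLaw (μ₀ : Measure (ℝ × ℝ)) (l : Fin n → ℝ) :
    Measure ((ℝ × ℝ) × (Fin n → ℝ × ℝ)) :=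
  μ₀.prod (Measure.pi fun i => stdPair.map (pairMap 1 (l i) 1))

instance (μ₀ : Measure (ℝ × ℝ)) [IsProbabilityMeasure μ₀] (l : Fin n → ℝ) :
    IsProbabilityMeasure (shearedLaw μ₀ l) := by
  unfold shearedLaw
  infer_instance

lemma shearedLaw_eq_withDensity (μ₀ : Measure (ℝ × ℝ)) [IsProbabilityMeasure μ₀]
    (l : Fin n → ℝ) : shearedLaw μ₀ l = (μ₀.prod (Measure.pi fun _ : Fin n => stdPair)).withDensity
      fun w => ENNReal.ofReal (∏ i, shearDensity (l i) (w.2 i)) := by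
  have hm (i : Fin n) : Measurable fun p => ENNReal.ofReal (shearDensity (l i) p) := by fun_prop
  unfold shearedLaw
  simp only [map_shear]
  rw [pi_withDensity _ hm fun i => by rw [← map_shear]; infer_instance,
    prod_withDensity_right (by fun_prop)]
  congr 1
  ext w
  rw [ENNReal.ofReal_prod_of_nonneg fun i _ => shearDensity_nonneg _ _]

lemma shearedLaw_zero (μ₀ : Measure (ℝ × ℝ)) [IsProbabilityMeasure μ₀] :
    shearedLaw μ₀ (0 : Fin n → ℝ) = μ₀.prod (Measure.pi fun _ : Fin n => stdPair) := by
  unfold shearedLaw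
  have : (pairMap 1 0 1 : ℝ × ℝ → ℝ × ℝ) = id := by ext p <;> simp
  simp [this]

lemma lintegral_prod_shearDensity_mul_le (μ₀ : Measure (ℝ × ℝ)) [IsProbabilityMeasure μ₀]
    {l l' : Fin n → ℝ} (h : ∀ i, |l i * l' i| ≤ 1 / 4) :
    ∫⁻ w, ENNReal.ofReal ((∏ i, shearDensity (l i) (w.2 i)) * ∏ i, shearDensity (l' i) (w.2 i))
        ∂(μ₀.prod (Measure.pi fun _ : Fin n => stdPair)) ≤
      ENNReal.ofReal (Real.exp (∑ i, (l i * l' i + 2 * (l i * l' i) ^ 2))) := by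
  have hm (i : Fin n) :
      Measurable fun p => ENNReal.ofReal (shearDensity (l i) p * shearDensity (l' i) p) := by
    fun_prop
  simp only [← Finset.prod_mul_distrib]
  simp only [ENNReal.ofReal_prod_of_nonneg fun i _ =>
    mul_nonneg (shearDensity_nonneg (l i) _) (shearDensity_nonneg (l' i) _)]
  rw [measurePreserving_snd.lintegral_comp (f := fun v : Fin n → ℝ × ℝ =>
    ∏ i, ENNReal.ofReal (shearDensity (l i) (v i) * shearDensity (l' i) (v i)))
    (Finset.measurable_prod _ fun i _ => (hm i).comp (measurable_pi_apply i)),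
    lintegral_pi_prod _ hm, Real.exp_sum,
    ENNReal.ofReal_prod_of_nonneg fun i _ => (Real.exp_pos _).le]
  exact Finset.prod_le_prod' fun i _ =>
    lintegral_shearDensity_mul_le (by linarith [neg_le_of_abs_le (h i)]) (le_of_abs_le (h i))

/-- Regression coefficients with random signs that are constant on blocks of at most `K` increments
cannot be detected when `n K ρ²` is small. -/
lemma exists_sign_measure_le (μ₀ : Measure (ℝ × ℝ)) [IsProbabilityMeasure μ₀]
    (bin : Fin n → Fin n) (lam : Fin n → ℝ) {ρ : ℝ} (hρ : ρ ≤ 1 / 4) (hlam : ∀ i, lam i ^ 2 ≤ ρ)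
    {K : ℕ} (hK : 1 ≤ K) (hbin : ∀ j, (Finset.univ.filter fun i => bin i = j).card ≤ K)
    {c : ℝ} (hc : 0 < c) (hsmall : Real.exp (5 / 2 * (n * K * ρ ^ 2)) ≤ 1 + c ^ 2)
    {A : Set ((ℝ × ℝ) × (Fin n → ℝ × ℝ))} (hA : MeasurableSet A) :
    ∃ e : Fin n → Bool, shearedLaw μ₀ (0 : Fin n → ℝ) A ≤
      shearedLaw μ₀ (fun i => boolSign (e (bin i)) * lam i) A + ENNReal.ofReal c := by
  classical
  set ℓ : (Fin n → Bool) → (ℝ × ℝ) × (Fin n → ℝ × ℝ) → ℝ :=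
    fun e w => ∏ i, shearDensity (boolSign (e (bin i)) * lam i) (w.2 i) with hℓ
  set B : (Fin n → Bool) → (Fin n → Bool) → ℝ := fun e e' => Real.exp (∑ i,
    ((boolSign (e (bin i)) * lam i) * (boolSign (e' (bin i)) * lam i) +
      2 * ((boolSign (e (bin i)) * lam i) * (boolSign (e' (bin i)) * lam i)) ^ 2)) with hB
  have hmeas (e : Fin n → Bool) : Measurable (ℓ e) := Finset.measurable_prod _ fun i _ =>
    (measurable_shearDensity _).comp ((measurable_pi_apply i).comp measurable_snd)
  have h := exists_measure_le_withDensity_add (Q := μ₀.prod (Measure.pi fun _ : Fin n => stdPair))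
    (ℓ := ℓ) (B := B) hmeas
    (fun e w => Finset.prod_nonneg fun i _ => shearDensity_nonneg _ _) (fun e => ?_)
    (fun e e' => (Real.exp_pos _).le) (fun e e' => ?_) hc ?_ hA
  · simpa only [hℓ, ← shearedLaw_eq_withDensity, shearedLaw_zero] using h
  · have h := shearedLaw_eq_withDensity μ₀ fun i => boolSign (e (bin i)) * lam i
    rw [← setLIntegral_univ, ← withDensity_apply _ MeasurableSet.univ]
    simp only [hℓ]
    rw [← h, measure_univ]
  · refine lintegral_prod_shearDensity_mul_le μ₀ fun i => ?_
    rw [abs_mul, abs_mul, abs_mul, abs_boolSign, abs_boolSign, one_mul, ← sq, sq_abs]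
    exact (hlam i).trans hρ
  · set Λ : Fin n → ℝ := fun j => ∑ i ∈ Finset.univ.filter (fun i => bin i = j), lam i ^ 2 with hΛ
    -- The linear terms group by blocks, where the signs are constant, while the quadratic terms do
    -- not see the signs at all.
    have hBe (e e' : Fin n → Bool) : B e e' =
        Real.exp (∑ j, boolSign (e j) * boolSign (e' j) * Λ j) *
          Real.exp (∑ i, 2 * (lam i ^ 2) ^ 2) := by
      rw [← Real.exp_add]
      simp only [hB]
      congr 1
      rw [Finset.sum_add_distrib]
      congr 1
      · simp only [hΛ, Finset.mul_sum]
        rw [← Finset.sum_fiberwise Finset.univ bin]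
        refine Finset.sum_congr rfl fun j _ => Finset.sum_congr rfl fun i hi => ?_
        rw [(Finset.mem_filter.1 hi).2]
        ring
      · refine Finset.sum_congr rfl fun i _ => ?_
        rw [show boolSign (e (bin i)) * lam i * (boolSign (e' (bin i)) * lam i) =
          (boolSign (e (bin i)) * boolSign (e' (bin i))) * lam i ^ 2 by ring, mul_pow, mul_pow,
          boolSign_sq, boolSign_sq]
        ring
    -- That `ρ` is nonnegative is read off from an increment, so the case without increments is
    -- separate.
    rcases Nat.eq_zero_or_pos n with rfl | hn
    · simp [hB]; positivity
    have hρ0 : 0 ≤ ρ := (sq_nonneg _).trans (hlam ⟨0, hn⟩)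
    have hΛ0 (j : Fin n) : 0 ≤ Λ j := Finset.sum_nonneg fun i _ => sq_nonneg _
    have hΛK (j : Fin n) : Λ j ≤ K * ρ := by
      refine (Finset.sum_le_card_nsmul _ _ ρ fun i _ => hlam i).trans ?_
      rw [nsmul_eq_mul]
      gcongr
      exact hbin j
    have hΛsum : ∑ j, Λ j ≤ n * ρ := by
      rw [Finset.sum_fiberwise]
      refine (Finset.sum_le_card_nsmul _ _ ρ fun i _ => hlam i).trans ?_
      simp
    -- The sum of squares is at most the largest block sum times the total.
    have hsq : ∑ j, Λ j ^ 2 ≤ n * K * ρ ^ 2 := by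
      calc ∑ j, Λ j ^ 2 ≤ ∑ j, K * ρ * Λ j := Finset.sum_le_sum fun j _ => by
            rw [sq]; exact mul_le_mul_of_nonneg_right (hΛK j) (hΛ0 j)
        _ = K * ρ * ∑ j, Λ j := by rw [Finset.mul_sum]
        _ ≤ K * ρ * (n * ρ) := by gcongr
        _ = n * K * ρ ^ 2 := by ring
    have hfour : ∑ i, 2 * (lam i ^ 2) ^ 2 ≤ 2 * (n * K * ρ ^ 2) := by
      have hK' : (1 : ℝ) ≤ K := by exact_mod_cast hK
      calc ∑ i, 2 * (lam i ^ 2) ^ 2 ≤ ∑ _i : Fin n, 2 * ρ ^ 2 := Finset.sum_le_sum fun i _ => by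
            have := pow_le_pow_left₀ (sq_nonneg (lam i)) (hlam i) 2
            linarith
        _ = 2 * (n * 1 * ρ ^ 2) := by simp; ring
        _ ≤ 2 * (n * K * ρ ^ 2) := by gcongr
    have hrow (e : Fin n → Bool) : ∑ e', B e e' ≤ 2 ^ n * (1 + c ^ 2) := by
      simp only [hBe]
      rw [← Finset.sum_mul]
      calc _ ≤ (2 ^ Fintype.card (Fin n) * Real.exp ((∑ j, Λ j ^ 2) / 2)) *
            Real.exp (∑ i, 2 * (lam i ^ 2) ^ 2) := by
            gcongr
            exact sum_exp_boolSign_le e Λ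
        _ = 2 ^ n * Real.exp ((∑ j, Λ j ^ 2) / 2 + ∑ i, 2 * (lam i ^ 2) ^ 2) := by
            rw [Real.exp_add, Fintype.card_fin, mul_assoc]
        -- The factor `5 / 2` is `1 / 2` from the random signs plus `2` from the quadratic terms.
        _ ≤ 2 ^ n * Real.exp (5 / 2 * (n * K * ρ ^ 2)) := by
            gcongr
            linarith
        _ ≤ 2 ^ n * (1 + c ^ 2) := by gcongr
    calc ∑ e, ∑ e', B e e' ≤ ∑ _e : Fin n → Bool, (2 ^ n * (1 + c ^ 2)) :=
          Finset.sum_le_sum fun e _ => hrow e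
      _ = (Fintype.card (Fin n → Bool) : ℝ) ^ 2 * (1 + c ^ 2) := by
          simp
          ring

end Rademacher

/-! ### Waves of parabolic bumps. -/

section Wave

/-- The parabolic bump of period `1` that vanishes at the integers. -/
noncomputable def bump (x : ℝ) : ℝ := Int.fract x * (1 - Int.fract x)

/-- The function that equals the `k`-th coefficient times a parabolic bump on `[k, k + 1]`. -/
noncomputable def wave (e : ℤ → ℝ) (x : ℝ) : ℝ := e ⌊x⌋ * bump x

lemma bump_nonneg (x : ℝ) : 0 ≤ bump x :=
  mul_nonneg (Int.fract_nonneg x) (by linarith [Int.fract_lt_one x])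

lemma bump_le (x : ℝ) : bump x ≤ 1 / 4 := by
  unfold bump
  nlinarith [sq_nonneg (Int.fract x - 1 / 2)]

lemma bump_eq {x : ℝ} {k : ℤ} (h0 : (k : ℝ) ≤ x) (h1 : x ≤ k + 1) :
    bump x = (x - k) * (1 - (x - k)) := by
  rcases h1.lt_or_eq with h | h
  · have : ⌊x⌋ = k := Int.floor_eq_iff.2 ⟨h0, h⟩
    rw [bump, Int.fract, this]
  · have : Int.fract x = 0 := by rw [h]; simp
    rw [bump, this, h]
    ring

lemma bump_le_abs_sub (x : ℝ) (p : ℤ) : bump x ≤ |x - p| := by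
  have h0 := Int.fract_nonneg x
  have h1 := Int.fract_lt_one x
  have hx := Int.floor_add_fract x
  unfold bump
  rcases le_or_gt p ⌊x⌋ with h | h
  · have : (p : ℝ) ≤ ⌊x⌋ := by exact_mod_cast h
    have := le_abs_self (x - p)
    nlinarith
  · have : (⌊x⌋ : ℝ) + 1 ≤ p := by exact_mod_cast h
    have := neg_le_abs (x - p)
    nlinarith

/-- The right end point is allowed although `⌊x⌋` jumps there, because the bump vanishes at
integers. -/
lemma wave_eq (e : ℤ → ℝ) {x : ℝ} {k : ℤ} (h0 : (k : ℝ) ≤ x) (h1 : x ≤ k + 1) :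
    wave e x = e k * bump x := by
  rcases h1.lt_or_eq with h | h
  · have : ⌊x⌋ = k := Int.floor_eq_iff.2 ⟨h0, h⟩
    rw [wave, this]
  · have : bump x = 0 := by rw [bump_eq h0 h1, h]; ring
    rw [wave, this, mul_zero, mul_zero]

lemma abs_wave_le {e : ℤ → ℝ} {C : ℝ} (he : ∀ k, |e k| ≤ C) (x : ℝ) : |wave e x| ≤ C / 4 := by
  rw [wave, abs_mul, abs_of_nonneg (bump_nonneg x)]
  have h1 := bump_nonneg x
  have h2 := bump_le x
  nlinarith [he ⌊x⌋, abs_nonneg (e ⌊x⌋)]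

lemma abs_wave_le_abs_sub {e : ℤ → ℝ} {C : ℝ} (he : ∀ k, |e k| ≤ C) (x : ℝ) (p : ℤ) :
    |wave e x| ≤ C * |x - p| := by
  rw [wave, abs_mul, abs_of_nonneg (bump_nonneg x)]
  exact mul_le_mul (he _) (bump_le_abs_sub x p) (bump_nonneg x) ((abs_nonneg _).trans (he 0))

/-- Within a cell the bump has slope at most one. Across cells, both values are compared with the
zero at the intermediate integer `⌊y⌋`, so sign changes of the coefficients do not enlarge the
constant. -/
lemma abs_wave_sub_le {e : ℤ → ℝ} {C : ℝ} (he : ∀ k, |e k| ≤ C) (x y : ℝ) :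
    |wave e x - wave e y| ≤ C * |x - y| := by
  wlog hxy : x ≤ y generalizing x y
  · rw [abs_sub_comm, abs_sub_comm x]
    exact this y x (le_of_not_ge hxy)
  rcases (Int.floor_mono hxy).eq_or_lt with h | h
  · rw [wave, wave, h, ← mul_sub, abs_mul]
    refine mul_le_mul (he _) ?_ (abs_nonneg _) ((abs_nonneg _).trans (he 0))
    have e1 : bump x - bump y = (x - y) * (1 - Int.fract x - Int.fract y) := by
      have hx := Int.floor_add_fract x
      have hy := Int.floor_add_fract y
      rw [h] at hx
      have : x - y = Int.fract x - Int.fract y := by linarith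
      rw [bump, bump, this]
      ring
    rw [e1, abs_mul]
    refine mul_le_of_le_one_right (abs_nonneg _) (abs_le.2 ⟨?_, ?_⟩)
    · linarith [Int.fract_lt_one x, Int.fract_lt_one y]
    · linarith [Int.fract_nonneg x, Int.fract_nonneg y]
  · have h1 : x ≤ ⌊y⌋ := (Int.lt_floor_add_one x).le.trans (by exact_mod_cast h)
    have h2 : (⌊y⌋ : ℝ) ≤ y := Int.floor_le y
    calc |wave e x - wave e y| ≤ |wave e x| + |wave e y| := abs_sub _ _
      _ ≤ C * |x - ⌊y⌋| + C * |y - ⌊y⌋| :=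
          add_le_add (abs_wave_le_abs_sub he x _) (abs_wave_le_abs_sub he y _)
      _ = C * |x - y| := by
          rw [abs_of_nonpos (by linarith : x - ⌊y⌋ ≤ 0), abs_of_nonneg (by linarith : 0 ≤ y - ⌊y⌋),
            abs_of_nonpos (by linarith : x - y ≤ 0)]
          ring

/-- The Lipschitz bound serves at distances up to one, the uniform bound beyond. -/
lemma abs_wave_sub_le_rpow {e : ℤ → ℝ} {C : ℝ} (he : ∀ k, |e k| ≤ C) {α : ℝ} (hα : 0 < α)
    (hα' : α ≤ 1) (x y : ℝ) : |wave e x - wave e y| ≤ C * |x - y| ^ α := by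
  have hC : 0 ≤ C := (abs_nonneg _).trans (he 0)
  rcases le_total |x - y| 1 with h | h
  · refine (abs_wave_sub_le he x y).trans (mul_le_mul_of_nonneg_left ?_ hC)
    exact Real.self_le_rpow_of_le_one (abs_nonneg _) h hα'
  · have h1 : 1 ≤ |x - y| ^ α := Real.one_le_rpow h hα.le
    have h2 := abs_sub (wave e x) (wave e y)
    nlinarith [abs_wave_le he x, abs_wave_le he y]

lemma continuous_wave {e : ℤ → ℝ} {C : ℝ} (he : ∀ k, |e k| ≤ C) : Continuous (wave e) := by
  have hC : 0 ≤ C := (abs_nonneg _).trans (he 0)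
  have : LipschitzWith C.toNNReal (wave e) := by
    refine LipschitzWith.of_dist_le_mul fun x y => ?_
    rw [Real.coe_toNNReal _ hC]
    exact abs_wave_sub_le he x y
  exact this.continuous

lemma bump_eq_wave : bump = wave fun _ => 1 := by
  ext x
  simp [wave]

lemma continuous_bump : Continuous bump := by
  rw [bump_eq_wave]
  exact continuous_wave (C := 1) (by simp)

lemma integral_bump (k : ℤ) : ∫ x in (k : ℝ)..(k + 1), bump x = 1 / 6 := by
  have h : ∫ x in (k : ℝ)..(k + 1), bump x = ∫ x in (k : ℝ)..(k + 1), (x - k) * (1 - (x - k)) := by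
    refine intervalIntegral.integral_congr fun x hx => ?_
    rw [Set.uIcc_of_le (by linarith)] at hx
    exact bump_eq hx.1 hx.2
  rw [h, intervalIntegral.integral_comp_sub_right (fun x => x * (1 - x))]
  have : (fun x : ℝ => x * (1 - x)) = fun x => x - x ^ 2 := by ext; ring
  rw [this, intervalIntegral.integral_sub (by simp) (by simp)]
  norm_num [integral_id, integral_pow]

lemma integral_bump_sq (k : ℤ) : ∫ x in (k : ℝ)..(k + 1), bump x ^ 2 = 1 / 30 := by
  have h : ∫ x in (k : ℝ)..(k + 1), bump x ^ 2 =
      ∫ x in (k : ℝ)..(k + 1), ((x - k) * (1 - (x - k))) ^ 2 := by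
    refine intervalIntegral.integral_congr fun x hx => ?_
    rw [Set.uIcc_of_le (by linarith)] at hx
    simp only [bump_eq hx.1 hx.2]
  rw [h, intervalIntegral.integral_comp_sub_right (fun x => (x * (1 - x)) ^ 2)]
  have : (fun x : ℝ => (x * (1 - x)) ^ 2) = fun x => x ^ 2 - 2 * x ^ 3 + x ^ 4 := by ext; ring
  rw [this, intervalIntegral.integral_add (by simp) (by simp),
    intervalIntegral.integral_sub (by simp) (by simp), intervalIntegral.integral_const_mul]
  norm_num [integral_pow]

lemma integral_bump_sq_nat (k : ℕ) : ∫ x in (0 : ℝ)..k, bump x ^ 2 = k / 30 := by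
  induction k with
  | zero => simp
  | succ k ih =>
    have hi (a b : ℝ) : IntervalIntegrable (fun x => bump x ^ 2) volume a b :=
      (continuous_bump.pow 2).intervalIntegrable a b
    have := integral_bump_sq k
    push_cast at this ⊢
    rw [← intervalIntegral.integral_add_adjacent_intervals (hi 0 k) (hi k (k + 1)), ih, this]
    ring

/-- A wave with unit coefficients keeps a fixed proportion of its `L²`-mass at every frequency. -/
lemma le_integral_wave_sq {e : ℤ → ℝ} (he : ∀ k, |e k| = 1) {N : ℝ} (hN : 1 ≤ N) :
    1 / 60 ≤ ∫ x in (0 : ℝ)..1, wave e (N * x) ^ 2 := by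
  have hsq (x : ℝ) : wave e x ^ 2 = bump x ^ 2 := by
    rw [wave, mul_pow, ← sq_abs (e _), he]
    simp
  have hN0 : N ≠ 0 := by positivity
  simp only [hsq]
  rw [intervalIntegral.integral_comp_mul_left (fun x => bump x ^ 2) hN0, mul_zero, mul_one,
    smul_eq_mul]
  have hi (a b : ℝ) : IntervalIntegrable (fun x => bump x ^ 2) volume a b :=
    (continuous_bump.pow 2).intervalIntegrable a b
  have hfl : (⌊N⌋₊ : ℝ) ≤ N := Nat.floor_le (by linarith)
  -- Each complete cell contributes `1 / 30`. Since `N ≥ 1`, complete cells fill at least half of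
  -- `[0, N]`, which gives `1 / 60`.
  have h1 : (1 : ℝ) ≤ ⌊N⌋₊ := by exact_mod_cast Nat.one_le_floor_iff _ |>.2 hN
  have h2 := Nat.lt_floor_add_one N
  have h3 : (⌊N⌋₊ : ℝ) / 30 ≤ ∫ x in (0 : ℝ)..N, bump x ^ 2 := by
    rw [← integral_bump_sq_nat, ← intervalIntegral.integral_add_adjacent_intervals
      (hi 0 ⌊N⌋₊) (hi ⌊N⌋₊ N)]
    have := intervalIntegral.integral_nonneg (f := fun x => bump x ^ 2) (μ := volume) hfl
      fun x _ => sq_nonneg _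
    linarith
  rw [← div_eq_inv_mul, le_div_iff₀ (by linarith)]
  linarith

end Wave

/-! ### Regularity of the function classes. -/

section Holder

lemma continuousOn_of_holder {f : ℝ → ℝ} {C α : ℝ} (hα : 0 < α)
    (h : ∀ s ∈ Set.Icc (0 : ℝ) 1, ∀ t ∈ Set.Icc (0 : ℝ) 1, |f t - f s| ≤ C * |t - s| ^ α) :
    ContinuousOn f (Set.Icc 0 1) := by
  intro s hs
  rw [ContinuousWithinAt, tendsto_iff_dist_tendsto_zero]
  have hc : Continuous fun t : ℝ => C * |t - s| ^ α :=
    continuous_const.mul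
      ((continuous_id.sub continuous_const).abs.rpow_const fun _ => Or.inr hα.le)
  have h0 : Tendsto (fun t : ℝ => C * |t - s| ^ α) (𝓝[Set.Icc 0 1] s) (𝓝 0) := by
    have := (hc.tendsto s).mono_left (nhdsWithin_le_nhds (s := Set.Icc 0 1))
    simpa [Real.zero_rpow hα.ne'] using this
  refine tendsto_of_tendsto_of_tendsto_of_le_of_le' tendsto_const_nhds h0
    (Eventually.of_forall fun _ => dist_nonneg) ?_
  filter_upwards [self_mem_nhdsWithin] with t ht
  exact h s hs t ht

variable {α m M L : ℝ} {σ : ℝ → ℝ}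

lemma continuousOn_sq_of_mem_volClass (hα : 0 < α) (hσ : σ ∈ volClass α m M L) :
    ContinuousOn (fun s => σ s ^ 2) (Set.Icc 0 1) :=
  continuousOn_of_holder hα hσ.2

lemma continuousOn_of_mem_volClass (hα : 0 < α) (hσ : σ ∈ volClass α m M L) :
    ContinuousOn σ (Set.Icc 0 1) := by
  refine (continuousOn_sq_of_mem_volClass hα hσ).sqrt.congr fun s hs => ?_
  exact (Real.sqrt_sq (hσ.1 s hs).1.le).symm

lemma nonneg_of_mem_volClass (hσ : σ ∈ volClass α m M L) : 0 ≤ L := by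
  have := hσ.2 0 (by simp) 1 (by simp)
  simp only [sub_zero, abs_one, Real.one_rpow, mul_one] at this
  exact (abs_nonneg _).trans this

lemma volClass_mono {m' M' L' : ℝ} (hm : m' ≤ m) (hM : M ≤ M') (hL : L ≤ L')
    (hσ : σ ∈ volClass α m M L) : σ ∈ volClass α m' M' L' := by
  refine ⟨fun t ht => ⟨(hσ.1 t ht).1, hm.trans (hσ.1 t ht).2.1, (hσ.1 t ht).2.2.trans hM⟩,
    fun s hs t ht => (hσ.2 s hs t ht).trans ?_⟩
  gcongr

end Holder

/-! ### Reduction to standardized increments. -/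

section StandardizedLaw

variable {Ω : Type*} [MeasurableSpace Ω] {P : Measure Ω} {W W' : ℝ≥0 → Ω → ℝ} {X₀ Y₀ : Ω → ℝ}

/-- The observations as a function of the initial value and of the standardized increments. -/
noncomputable def fromStandardized {n : ℕ} (β : ℝ) (v s : Fin n → ℝ)
    (w : (ℝ × ℝ) × (Fin n → ℝ × ℝ)) : Fin (n + 1) → ℝ × ℝ :=
  partialSums (w.1, fun i => pairMap (√(v i)) (β * √(v i)) (√(s i)) (w.2 i))

lemma measurable_fromStandardized {n : ℕ} (β : ℝ) (v s : Fin n → ℝ) :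
    Measurable (fromStandardized β v s) :=
  measurable_partialSums.comp (measurable_fst.prodMk (measurable_pi_lambda _ fun i =>
    (pairMap _ _ _).continuous.measurable.comp ((measurable_pi_apply i).comp measurable_snd)))

/-- The law of the observations, standardized by the volatilities of the null hypothesis. -/
lemma pathLaw_eq_shearedLaw [IsProbabilityMeasure P] (h : IsNoise P W W' X₀ Y₀) {b σ τ : ℝ → ℝ}
    (hb : ContinuousOn b (Set.Icc 0 1)) (hσ : ContinuousOn σ (Set.Icc 0 1))
    (hτ : ContinuousOn τ (Set.Icc 0 1)) {n : ℕ} (β : ℝ) {v s l : Fin n → ℝ}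
    (hv0 : ∀ i, 0 ≤ v i) (hs0 : ∀ i, 0 ≤ s i)
    (hv : ∀ i : Fin n, v i = ∫ r in ((i : ℝ) / n)..(((i : ℝ) + 1) / n), σ r ^ 2)
    (hc : ∀ i : Fin n, ∫ r in ((i : ℝ) / n)..(((i : ℝ) + 1) / n), b r * σ r ^ 2 =
      β * v i + √(v i) * √(s i) * l i)
    (hs : ∀ i : Fin n, ∫ r in ((i : ℝ) / n)..(((i : ℝ) + 1) / n), (b r ^ 2 * σ r ^ 2 + τ r ^ 2) =
      (β * √(v i) + √(s i) * l i) ^ 2 + s i)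
    {A : Set (Fin (n + 1) → ℝ × ℝ)} (hA : MeasurableSet A) :
    pathLaw P W W' X₀ Y₀ b σ τ {w | observe n w ∈ A} =
      shearedLaw (P.map fun ω => (X₀ ω, Y₀ ω)) l (fromStandardized β v s ⁻¹' A) := by
  have : IsProbabilityMeasure (P.map fun ω => (X₀ ω, Y₀ ω)) :=
    Measure.isProbabilityMeasure_map
      (h.measurable_init_fst.prodMk h.measurable_init_snd).aemeasurable
  rw [pathLaw_observe h hb hσ hτ (x := fun i => √(v i)) (y := fun i => β * √(v i) + √(s i) * l i)
    (z := fun i => √(s i)) (fun i => by rw [Real.sq_sqrt (hv0 i), hv i])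
    (fun i => by
      rw [hc i, mul_add, ← mul_assoc, mul_comm _ β, mul_assoc, Real.mul_self_sqrt (hv0 i),
        mul_assoc])
    (fun i => by rw [hs i, Real.sq_sqrt (hs0 i)]) hA]
  set F : Fin n → ℝ × ℝ → ℝ × ℝ := fun i => pairMap (√(v i)) (β * √(v i)) (√(s i)) with hF
  have hFm (i : Fin n) : Measurable (F i) := (pairMap _ _ _).continuous.measurable
  -- The linear map factors into the shear by `l i` and a map `F i` free of `l`. Pulling tests back
  -- through `F` reduces the problem to sheared laws.
  have hcomp (i : Fin n) : stdPair.map (pairMap (√(v i)) (β * √(v i) + √(s i) * l i) (√(s i))) =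
      (stdPair.map (pairMap 1 (l i) 1)).map (F i) := by
    rw [Measure.map_map (hFm i) (by fun_prop)]
    congr 1
    ext p <;> simp [hF]
    ring
  have hprob (i : Fin n) : IsProbabilityMeasure ((stdPair.map (pairMap 1 (l i) 1)).map (F i)) :=
    Measure.isProbabilityMeasure_map (hFm i).aemeasurable
  have hFpi : Measurable fun (w : Fin n → ℝ × ℝ) i => F i (w i) :=
    measurable_pi_lambda _ fun i => (hFm i).comp (measurable_pi_apply i)
  simp only [hcomp]
  rw [← Measure.pi_map_pi fun i => (hFm i).aemeasurable, ← Measure.map_id (μ := P.map _),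
    Measure.map_prod_map _ _ measurable_id hFpi, Measure.map_apply (measurable_id.prodMap hFpi)
      (measurable_partialSums hA), Measure.map_id]
  rfl

end StandardizedLaw

/-! ### Alternatives with unchanged conditional variances. -/

section Alternative

variable {α m M L R β m₀ M₀ L₀ : ℝ} {σ₀ τ₀ : ℝ → ℝ}

lemma grid_subset {n : ℕ} (i : Fin n) :
    (i : ℝ) / n ≤ ((i : ℝ) + 1) / n ∧
      Set.Icc ((i : ℝ) / n) (((i : ℝ) + 1) / n) ⊆ Set.Icc (0 : ℝ) 1 := by
  refine ⟨by gcongr; linarith, Set.Icc_subset_Icc (by positivity) ?_⟩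
  refine div_le_one_of_le₀ ?_ (by positivity)
  exact_mod_cast i.2

lemma grid_length {n : ℕ} (i : Fin n) : ((i : ℝ) + 1) / n - (i : ℝ) / n = 1 / n := by
  rw [← sub_div]
  ring

lemma le_gridIntegral_sq (hα : 0 < α) (hσ : σ₀ ∈ volClass α m₀ M₀ L₀) {n : ℕ} (i : Fin n) :
    m₀ / n ≤ ∫ r in ((i : ℝ) / n)..(((i : ℝ) + 1) / n), σ₀ r ^ 2 := by
  obtain ⟨h1, h2⟩ := grid_subset i
  have hi : IntervalIntegrable (fun r => σ₀ r ^ 2) volume ((i : ℝ) / n) (((i : ℝ) + 1) / n) :=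
    ((continuousOn_sq_of_mem_volClass hα hσ).mono
      (by rwa [Set.uIcc_of_le h1])).intervalIntegrable
  calc m₀ / n = ∫ _ in ((i : ℝ) / n)..(((i : ℝ) + 1) / n), m₀ := by
        rw [intervalIntegral.integral_const, grid_length, smul_eq_mul]; ring
    _ ≤ _ := intervalIntegral.integral_mono_on h1 intervalIntegrable_const hi
        fun r hr => (hσ.1 r (h2 hr)).2.1

lemma integral_wave_grid (e : ℤ → ℝ) {n : ℕ} (i : Fin n) :
    ∫ r in ((i : ℝ) / n)..(((i : ℝ) + 1) / n), wave e (n * r) = e i / (6 * n) := by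
  have hn : (n : ℝ) ≠ 0 := by
    have := i.pos
    positivity
  rw [intervalIntegral.integral_comp_mul_left (wave e) hn, mul_div_cancel₀ _ hn,
    mul_div_cancel₀ _ hn]
  have h : ∫ x in (i : ℝ)..(i + 1), wave e x = ∫ x in (((i : ℕ) : ℤ) : ℝ)..(((i : ℕ) : ℤ) + 1),
      e i * bump x := by
    push_cast
    refine intervalIntegral.integral_congr fun x hx => ?_
    rw [Set.uIcc_of_le (by linarith)] at hx
    exact wave_eq e (by exact_mod_cast hx.1) (by exact_mod_cast hx.2)
  rw [h, intervalIntegral.integral_const_mul, integral_bump, smul_eq_mul]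
  field_simp

set_option maxHeartbeats 1000000 in
/-- A perturbation `g / σ₀²` of a constant beta can be complemented by a perturbation of the
idiosyncratic volatility such that the conditional variances of the increments do not change. -/
lemma exists_alternative (hα : 0 < α) (hα' : α ≤ 1) (hβ : 0 < β) (hβR : β < R) (hm₀ : 0 < m₀)
    (hm : 0 < m) (hmm : m < m₀) (hMM : M₀ < M)
    (hσ : σ₀ ∈ volClass α m₀ M₀ L₀) (hτ : τ₀ ∈ volClass α m₀ M₀ L₀) {n : ℕ} (hn : 0 < n)
    {g : ℝ → ℝ} {a : ℝ}
    (hg : ∀ s ∈ Set.Icc (0 : ℝ) 1, ∀ t ∈ Set.Icc (0 : ℝ) 1,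
      |g t - g s| ≤ R * m₀ / 2 * |t - s| ^ α)
    (hga : ∀ t ∈ Set.Icc (0 : ℝ) 1, |g t| ≤ a) (ha1 : a * L₀ ≤ R * m₀ ^ 2 / 2)
    (ha2 : a ≤ (R - β) * m₀) (ha3 : a ^ 2 ≤ m₀ * M₀)
    (hn1 : 6 * (M₀ * R ^ 2) * (n : ℝ) ^ (-α) ≤ L - L₀)
    (hn2 : 6 * (M₀ * R ^ 2) * (n : ℝ) ^ (-α) ≤ m₀ - m) :
    ∃ b τ : ℝ → ℝ, b ∈ holderBall α R ∧ τ ∈ volClass α m M L ∧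
      (∫ t in (0 : ℝ)..1, g t ^ 2) / (2 * M₀ ^ 2) ≤ sqSeparation β b σ₀ τ ∧
      (∀ i : Fin n, ∫ r in ((i : ℝ) / n)..(((i : ℝ) + 1) / n), b r * σ₀ r ^ 2 =
        β * (∫ r in ((i : ℝ) / n)..(((i : ℝ) + 1) / n), σ₀ r ^ 2) +
          ∫ r in ((i : ℝ) / n)..(((i : ℝ) + 1) / n), g r) ∧
      ∀ i : Fin n, ∫ r in ((i : ℝ) / n)..(((i : ℝ) + 1) / n), (b r ^ 2 * σ₀ r ^ 2 + τ r ^ 2) =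
        β ^ 2 * (∫ r in ((i : ℝ) / n)..(((i : ℝ) + 1) / n), σ₀ r ^ 2) +
          2 * β * (∫ r in ((i : ℝ) / n)..(((i : ℝ) + 1) / n), g r) +
          (∫ r in ((i : ℝ) / n)..(((i : ℝ) + 1) / n), g r) ^ 2 /
            (∫ r in ((i : ℝ) / n)..(((i : ℝ) + 1) / n), σ₀ r ^ 2) +
          ∫ r in ((i : ℝ) / n)..(((i : ℝ) + 1) / n), τ₀ r ^ 2 := by
  have hR : 0 < R := hβ.trans hβR
  have hL₀ : 0 ≤ L₀ := nonneg_of_mem_volClass hσ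
  have hM₀ : 0 < M₀ := by
    have := hσ.1 0 (by simp)
    linarith
  have ha : 0 ≤ a := (abs_nonneg _).trans (hga 0 (by simp))
  have hn' : (0 : ℝ) < n := by exact_mod_cast hn
  have hσpos (t : ℝ) (ht : t ∈ Set.Icc (0 : ℝ) 1) : 0 < σ₀ t ^ 2 :=
    hm₀.trans_le (hσ.1 t ht).2.1
  have hσc := continuousOn_sq_of_mem_volClass hα hσ
  have hτc := continuousOn_sq_of_mem_volClass hα hτ
  have hgc : ContinuousOn g (Set.Icc 0 1) := continuousOn_of_holder hα hg
  -- Dividing by `σ₀²` makes the change of the covariance on each interval exactly the integral of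
  -- `g`.
  set δ : ℝ → ℝ := fun t => g t / σ₀ t ^ 2 with hδ
  have hδc : ContinuousOn δ (Set.Icc 0 1) := hgc.div hσc fun t ht => (hσpos t ht).ne'
  have hδσ (t : ℝ) (ht : t ∈ Set.Icc (0 : ℝ) 1) : δ t * σ₀ t ^ 2 = g t :=
    div_mul_cancel₀ _ (hσpos t ht).ne'
  have hδholder (s : ℝ) (hs : s ∈ Set.Icc (0 : ℝ) 1) (t : ℝ) (ht : t ∈ Set.Icc (0 : ℝ) 1) :
      |δ t - δ s| ≤ R * |t - s| ^ α := by
    -- Half of the Hölder budget `R` pays for the variation of `g`, the other half for that of `1 /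
    -- σ₀²`.
    have e : δ t - δ s = (g t - g s) / σ₀ t ^ 2 -
        g s * (σ₀ t ^ 2 - σ₀ s ^ 2) / (σ₀ t ^ 2 * σ₀ s ^ 2) := by
      have h1 := (hσ.1 t ht).1.ne'
      have h2 := (hσ.1 s hs).1.ne'
      simp only [hδ]
      field_simp
      ring
    have hpow : 0 ≤ |t - s| ^ α := by positivity
    have b1 : |(g t - g s) / σ₀ t ^ 2| ≤ R / 2 * |t - s| ^ α := by
      rw [abs_div, abs_of_pos (hσpos t ht), div_le_iff₀ (hσpos t ht)]
      refine (hg s hs t ht).trans ?_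
      have := (hσ.1 t ht).2.1
      calc R * m₀ / 2 * |t - s| ^ α = R / 2 * |t - s| ^ α * m₀ := by ring
        _ ≤ R / 2 * |t - s| ^ α * σ₀ t ^ 2 := by gcongr
    have b2 : |g s * (σ₀ t ^ 2 - σ₀ s ^ 2) / (σ₀ t ^ 2 * σ₀ s ^ 2)| ≤ R / 2 * |t - s| ^ α := by
      have hprod : m₀ ^ 2 ≤ σ₀ t ^ 2 * σ₀ s ^ 2 := by
        rw [sq m₀]
        exact mul_le_mul (hσ.1 t ht).2.1 (hσ.1 s hs).2.1 hm₀.le (hσpos t ht).le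
      rw [abs_div, abs_mul, abs_of_pos (mul_pos (hσpos t ht) (hσpos s hs)),
        div_le_iff₀ (mul_pos (hσpos t ht) (hσpos s hs))]
      calc |g s| * |σ₀ t ^ 2 - σ₀ s ^ 2| ≤ a * (L₀ * |t - s| ^ α) :=
            mul_le_mul (hga s hs) (hσ.2 s hs t ht) (abs_nonneg _) ha
        _ = a * L₀ * |t - s| ^ α := by ring
        _ ≤ R * m₀ ^ 2 / 2 * |t - s| ^ α := by gcongr
        _ = R / 2 * |t - s| ^ α * m₀ ^ 2 := by ring
        _ ≤ R / 2 * |t - s| ^ α * (σ₀ t ^ 2 * σ₀ s ^ 2) := by gcongr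
    rw [e]
    refine (abs_sub _ _).trans ?_
    linarith
  have hδa (t : ℝ) (ht : t ∈ Set.Icc (0 : ℝ) 1) : |δ t| ≤ R - β := by
    simp only [hδ]
    rw [abs_div, abs_of_pos (hσpos t ht), div_le_iff₀ (hσpos t ht)]
    refine ((hga t ht).trans ha2).trans ?_
    exact mul_le_mul_of_nonneg_left (hσ.1 t ht).2.1 (by linarith)
  -- integrals over the grid intervals
  set lo : Fin n → ℝ := fun i => (i : ℝ) / n with hlo
  set hi : Fin n → ℝ := fun i => ((i : ℝ) + 1) / n with hhi
  have hle (i : Fin n) : lo i ≤ hi i := (grid_subset i).1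
  have hsub (i : Fin n) : Set.Icc (lo i) (hi i) ⊆ Set.Icc (0 : ℝ) 1 := (grid_subset i).2
  have hint {f : ℝ → ℝ} (hf : ContinuousOn f (Set.Icc 0 1)) (i : Fin n) :
      IntervalIntegrable f volume (lo i) (hi i) :=
    (hf.mono (by rw [Set.uIcc_of_le (hle i)]; exact hsub i)).intervalIntegrable
  have hcongr {f f' : ℝ → ℝ} (hf : ∀ t ∈ Set.Icc (0 : ℝ) 1, f t = f' t) (i : Fin n) :
      ∫ r in lo i..hi i, f r = ∫ r in lo i..hi i, f' r :=
    intervalIntegral.integral_congr fun r hr => by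
      rw [Set.uIcc_of_le (hle i)] at hr
      exact hf r (hsub i hr)
  set v : Fin n → ℝ := fun i => ∫ r in lo i..hi i, σ₀ r ^ 2 with hv
  set d : Fin n → ℝ := fun i => ∫ r in lo i..hi i, g r with hd
  set D : Fin n → ℝ := fun i => ∫ r in lo i..hi i, δ r ^ 2 * σ₀ r ^ 2 with hD
  have hvpos (i : Fin n) : 0 < v i := (div_pos hm₀ hn').trans_le (le_gridIntegral_sq hα hσ i)
  have hexp (i : Fin n) (c : ℝ) :
      ∫ r in lo i..hi i, (δ r - c) ^ 2 * σ₀ r ^ 2 = D i - 2 * c * d i + c ^ 2 * v i := by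
    have e : ∀ r ∈ Set.Icc (0 : ℝ) 1, (δ r - c) ^ 2 * σ₀ r ^ 2 =
        δ r ^ 2 * σ₀ r ^ 2 - 2 * c * g r + c ^ 2 * σ₀ r ^ 2 := fun r hr => by
      rw [← hδσ r hr]; ring
    rw [hcongr e i, intervalIntegral.integral_add, intervalIntegral.integral_sub,
      intervalIntegral.integral_const_mul, intervalIntegral.integral_const_mul]
    all_goals
      apply hint
      fun_prop
  -- This is the excess conditional variance to be compensated. It is the minimum over constants `c`
  -- of `∫ (δ - c)² σ₀²`, attained at `c = d i / v i`, hence nonnegative.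
  set ε : Fin n → ℝ := fun i => D i - d i ^ 2 / v i with hε
  have hε0 (i : Fin n) : 0 ≤ ε i := by
    have h1 := hexp i (d i / v i)
    have h2 : 0 ≤ ∫ r in lo i..hi i, (δ r - d i / v i) ^ 2 * σ₀ r ^ 2 :=
      intervalIntegral.integral_nonneg (hle i) fun r _ => by positivity
    have h3 : D i - 2 * (d i / v i) * d i + (d i / v i) ^ 2 * v i = ε i := by
      have := (hvpos i).ne'
      simp only [hε]
      field_simp
      ring
    rw [← h3, ← h1]
    exact h2
  have hεle (i : Fin n) : ε i ≤ M₀ * R ^ 2 * (n : ℝ) ^ (-(2 * α)) / n := by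
    have hlo01 : lo i ∈ Set.Icc (0 : ℝ) 1 := hsub i ⟨le_rfl, hle i⟩
    -- The competitor `c = δ (lo i)` bounds the minimum through the Hölder modulus of `δ`.
    have h1 : ε i ≤ ∫ r in lo i..hi i, (δ r - δ (lo i)) ^ 2 * σ₀ r ^ 2 := by
      rw [hexp i]
      have : 0 ≤ (δ (lo i) * v i - d i) ^ 2 / v i := div_nonneg (sq_nonneg _) (hvpos i).le
      have e : (δ (lo i) * v i - d i) ^ 2 / v i =
          δ (lo i) ^ 2 * v i - 2 * δ (lo i) * d i + d i ^ 2 / v i := by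
        have := (hvpos i).ne'
        field_simp
        ring
      simp only [hε]
      linarith
    refine h1.trans ?_
    calc ∫ r in lo i..hi i, (δ r - δ (lo i)) ^ 2 * σ₀ r ^ 2
        ≤ ∫ _ in lo i..hi i, (R ^ 2 * (n : ℝ) ^ (-(2 * α))) * M₀ := by
          refine intervalIntegral.integral_mono_on (hle i) (hint (by fun_prop) i)
            intervalIntegrable_const fun r hr => ?_
          have hr01 := hsub i hr
          have hdist : |r - lo i| ≤ (n : ℝ)⁻¹ := by
            rw [abs_of_nonneg (sub_nonneg.2 hr.1)]
            have h := grid_length i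
            rw [one_div] at h
            have := hr.2
            simp only [hlo, hhi] at this ⊢
            linarith
          have hb : |δ r - δ (lo i)| ≤ R * (n : ℝ) ^ (-α) := by
            refine (hδholder _ hlo01 _ hr01).trans ?_
            rw [Real.rpow_neg hn'.le, ← Real.inv_rpow hn'.le]
            gcongr
          have hsq : (δ r - δ (lo i)) ^ 2 ≤ R ^ 2 * (n : ℝ) ^ (-(2 * α)) := by
            rw [← sq_abs]
            refine (pow_le_pow_left₀ (abs_nonneg _) hb 2).trans (le_of_eq ?_)
            rw [mul_pow, ← Real.rpow_natCast, ← Real.rpow_natCast ((n : ℝ) ^ (-α)),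
              ← Real.rpow_mul hn'.le, Real.rpow_natCast]
            congr 2
            push_cast
            ring
          exact mul_le_mul hsq (hσ.1 r hr01).2.2 (hσpos r hr01).le (by positivity)
      _ = M₀ * R ^ 2 * (n : ℝ) ^ (-(2 * α)) / n := by
          rw [intervalIntegral.integral_const, hlo, hhi, grid_length, smul_eq_mul]
          ring
  -- the perturbed volatility
  set κ : ℤ → ℝ := fun k => if h : 0 ≤ k ∧ k < n then
    6 * n * ε ⟨k.toNat, by omega⟩ else 0 with hκ
  set η : ℝ := 6 * (M₀ * R ^ 2) * (n : ℝ) ^ (-(2 * α)) with hη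
  have hη0 : 0 ≤ η := by positivity
  -- The factor `6 * n` undoes the integral `1 / (6 * n)` of one bump over an observation interval.
  have hκi (i : Fin n) : κ i = 6 * n * ε i := by
    simp only [hκ]
    rw [dif_pos ⟨by positivity, by exact_mod_cast i.2⟩]
    simp
  have hκ0 (k : ℤ) : 0 ≤ κ k := by
    simp only [hκ]
    split_ifs
    · exact mul_nonneg (by positivity) (hε0 _)
    · exact le_rfl
  have hκη (k : ℤ) : |κ k| ≤ η := by
    rw [abs_of_nonneg (hκ0 k)]
    simp only [hκ]
    split_ifs with h
    · refine (mul_le_mul_of_nonneg_left (hεle _) (by positivity)).trans (le_of_eq ?_)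
      rw [hη]
      field_simp
    · exact hη0
  have hn1' : (1 : ℝ) ≤ n := by exact_mod_cast hn
  -- Running the wave at frequency `n` costs a factor `n^α` in the Hölder constant, which the height
  -- of order `n^(-2α)` can afford.
  have hηα : η * (n : ℝ) ^ α = 6 * (M₀ * R ^ 2) * (n : ℝ) ^ (-α) := by
    rw [hη, mul_assoc, ← Real.rpow_add hn']
    congr 2
    ring
  have hηle : η ≤ 6 * (M₀ * R ^ 2) * (n : ℝ) ^ (-α) := by
    rw [← hηα]
    exact le_mul_of_one_le_right hη0 (Real.one_le_rpow hn1' hα.le)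
  -- The idiosyncratic variance loses exactly `ε i` on the `i`-th interval.
  set q : ℝ → ℝ := fun t => τ₀ t ^ 2 - wave κ (n * t) with hq
  have hw0 (x : ℝ) : 0 ≤ wave κ x := mul_nonneg (hκ0 _) (bump_nonneg x)
  have hwle (x : ℝ) : wave κ x ≤ m₀ - m := by
    have := (le_abs_self _).trans (abs_wave_le hκη x)
    linarith
  have hqm (t : ℝ) (ht : t ∈ Set.Icc (0 : ℝ) 1) : m ≤ q t := by
    have := (hτ.1 t ht).2.1
    have := hwle (n * t)
    simp only [hq]
    linarith
  have hqM (t : ℝ) (ht : t ∈ Set.Icc (0 : ℝ) 1) : q t ≤ M₀ := by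
    have := (hτ.1 t ht).2.2
    have := hw0 (n * t)
    simp only [hq]
    linarith
  have hsqrt (t : ℝ) (ht : t ∈ Set.Icc (0 : ℝ) 1) : √(q t) ^ 2 = q t :=
    Real.sq_sqrt (hm.le.trans (hqm t ht))
  have hwc : Continuous fun t : ℝ => wave κ (n * t) :=
    (continuous_wave hκη).comp (continuous_const.mul continuous_id)
  have hqc : ContinuousOn q (Set.Icc 0 1) := hτc.sub hwc.continuousOn
  have hgint : IntervalIntegrable (fun t => g t ^ 2 / (2 * M₀ ^ 2)) volume 0 1 := by
    refine ContinuousOn.intervalIntegrable ?_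
    rw [Set.uIcc_of_le zero_le_one]
    fun_prop
  refine ⟨fun t => β + δ t, fun t => √(q t), ⟨fun s hs t ht => ?_, fun t ht => ?_⟩,
    ⟨fun t ht => ⟨Real.sqrt_pos.2 (hm.trans_le (hqm t ht)), ?_, ?_⟩, fun s hs t ht => ?_⟩,
    ?_, fun i => ?_, fun i => ?_⟩
  · rw [add_sub_add_left_eq_sub]
    exact hδholder s hs t ht
  · refine (abs_add_le _ _).trans ?_
    rw [abs_of_pos hβ]
    linarith [hδa t ht]
  · rw [hsqrt t ht]
    exact hqm t ht
  · rw [hsqrt t ht]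
    exact (hqM t ht).trans hMM.le
  · rw [hsqrt t ht, hsqrt s hs]
    have hw := abs_wave_sub_le_rpow hκη hα hα' (n * t) (n * s)
    rw [← mul_sub, abs_mul, abs_of_pos hn', Real.mul_rpow hn'.le (abs_nonneg _), ← mul_assoc,
      hηα] at hw
    have hpow : 0 ≤ |t - s| ^ α := by positivity
    have e : q t - q s = (τ₀ t ^ 2 - τ₀ s ^ 2) - (wave κ (n * t) - wave κ (n * s)) := by
      simp only [hq]
      ring
    rw [e]
    refine (abs_sub _ _).trans ((add_le_add (hτ.2 s hs t ht) hw).trans ?_)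
    rw [← add_mul]
    gcongr
    linarith
  · rw [sqSeparation, ← intervalIntegral.integral_div]
    refine intervalIntegral.integral_mono_on zero_le_one hgint ?_ fun t ht => ?_
    · refine ContinuousOn.intervalIntegrable ?_
      rw [Set.uIcc_of_le zero_le_one]
      have hqc' : ContinuousOn (fun t => √(q t)) (Set.Icc 0 1) := hqc.sqrt
      refine ContinuousOn.div (by fun_prop) (by fun_prop) fun t ht => ?_
      have := hm.trans_le (hqm t ht)
      rw [hsqrt t ht]
      positivity
    -- The integrand is `x / (x + q)` with `g² / M₀ ≤ x ≤ M₀` and `q ≤ M₀`, hence at least `g² / (2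
    -- M₀²)`.
    · have hS : σ₀ t ^ 2 * (β + δ t - β) ^ 2 = g t ^ 2 / σ₀ t ^ 2 := by
        have := (hσ.1 t ht).1.ne'
        simp only [hδ, add_sub_cancel_left]
        field_simp
      have hq0 := hm.trans_le (hqm t ht)
      rw [hS, hsqrt t ht]
      have h1 : g t ^ 2 / M₀ ≤ g t ^ 2 / σ₀ t ^ 2 := by
        gcongr
        · exact hσpos t ht
        · exact (hσ.1 t ht).2.2
      have h2 : g t ^ 2 / σ₀ t ^ 2 ≤ M₀ := by
        rw [div_le_iff₀ (hσpos t ht), ← sq_abs]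
        calc |g t| ^ 2 ≤ a ^ 2 := pow_le_pow_left₀ (abs_nonneg _) (hga t ht) 2
          _ ≤ m₀ * M₀ := ha3
          _ ≤ M₀ * σ₀ t ^ 2 := by rw [mul_comm]; gcongr; exact (hσ.1 t ht).2.1
      have h3 : 0 ≤ g t ^ 2 / σ₀ t ^ 2 := by positivity
      calc g t ^ 2 / (2 * M₀ ^ 2) = (g t ^ 2 / M₀) / (2 * M₀) := by field_simp
        _ ≤ (g t ^ 2 / σ₀ t ^ 2) / (g t ^ 2 / σ₀ t ^ 2 + q t) := by
            gcongr
            linarith [hqM t ht]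
  · have e : ∀ r ∈ Set.Icc (0 : ℝ) 1, (β + δ r) * σ₀ r ^ 2 = β * σ₀ r ^ 2 + g r := fun r hr => by
      rw [← hδσ r hr]; ring
    have h1 := hcongr e i
    have c1 : ContinuousOn (fun r => β * σ₀ r ^ 2) (Set.Icc 0 1) := continuousOn_const.mul hσc
    rw [intervalIntegral.integral_add (hint c1 i) (hint hgc i),
      intervalIntegral.integral_const_mul] at h1
    exact h1
  · have e : ∀ r ∈ Set.Icc (0 : ℝ) 1, (β + δ r) ^ 2 * σ₀ r ^ 2 + √(q r) ^ 2 =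
        β ^ 2 * σ₀ r ^ 2 + 2 * β * g r + δ r ^ 2 * σ₀ r ^ 2 + (τ₀ r ^ 2 - wave κ (n * r)) :=
      fun r hr => by
        rw [← hδσ r hr, hsqrt r hr]; ring
    have h1 := hcongr e i
    have hwi : ∫ r in lo i..hi i, wave κ (n * r) = ε i := by
      simp only [hlo, hhi]
      rw [integral_wave_grid, hκi]
      field_simp
    have c1 : ContinuousOn (fun r => β ^ 2 * σ₀ r ^ 2) (Set.Icc 0 1) := continuousOn_const.mul hσc
    have c2 : ContinuousOn (fun r => 2 * β * g r) (Set.Icc 0 1) := continuousOn_const.mul hgc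
    have c3 : ContinuousOn (fun r => δ r ^ 2 * σ₀ r ^ 2) (Set.Icc 0 1) := (hδc.pow 2).mul hσc
    have c12 : ContinuousOn (fun r => β ^ 2 * σ₀ r ^ 2 + 2 * β * g r) (Set.Icc 0 1) := c1.add c2
    have c123 : ContinuousOn (fun r => β ^ 2 * σ₀ r ^ 2 + 2 * β * g r + δ r ^ 2 * σ₀ r ^ 2)
      (Set.Icc 0 1) := c12.add c3
    have c4 : ContinuousOn (fun r => τ₀ r ^ 2 - wave κ (n * r)) (Set.Icc 0 1) := hqc
    rw [intervalIntegral.integral_add (hint c123 i) (hint c4 i),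
      intervalIntegral.integral_add (hint c12 i) (hint c3 i),
      intervalIntegral.integral_add (hint c1 i) (hint c2 i),
      intervalIntegral.integral_sub (hint hτc i) (hint hwc.continuousOn i),
      intervalIntegral.integral_const_mul, intervalIntegral.integral_const_mul, hwi] at h1
    refine h1.trans ?_
    simp only [hε]
    ring

end Alternative

/-! ### From indistinguishable families to the minimax error. -/

section LowerBound

variable {Ω : Type*} [MeasurableSpace Ω] {P : Measure Ω} {W W' : ℝ≥0 → Ω → ℝ} {X₀ Y₀ : Ω → ℝ}
  {α m M L R β m₀ M₀ L₀ : ℝ} {σ₀ τ₀ : ℝ → ℝ}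

/-- The integral of the squared volatility over the `i`-th observation interval. -/
noncomputable def gridVar {n : ℕ} (σ : ℝ → ℝ) (i : Fin n) : ℝ :=
  ∫ r in ((i : ℝ) / n)..(((i : ℝ) + 1) / n), σ r ^ 2

lemma gridVar_pos (hα : 0 < α) (hm₀ : 0 < m₀) (hσ : σ₀ ∈ volClass α m₀ M₀ L₀) {n : ℕ}
    (i : Fin n) : 0 < gridVar σ₀ i := by
  have := i.pos
  exact (by positivity : 0 < m₀ / n).trans_le (le_gridIntegral_sq hα hσ i)

lemma pathLaw_null [IsProbabilityMeasure P] (h : IsNoise P W W' X₀ Y₀) (hα : 0 < α)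
    (hm₀ : 0 < m₀) (hσ : σ₀ ∈ volClass α m₀ M₀ L₀) (hτ : τ₀ ∈ volClass α m₀ M₀ L₀) {n : ℕ}
    {A : Set (Fin (n + 1) → ℝ × ℝ)} (hA : MeasurableSet A) :
    pathLaw P W W' X₀ Y₀ (fun _ => β) σ₀ τ₀ {w | observe n w ∈ A} =
      shearedLaw (P.map fun ω => (X₀ ω, Y₀ ω)) 0
        (fromStandardized β (gridVar σ₀) (gridVar τ₀) ⁻¹' A) := by
  refine pathLaw_eq_shearedLaw h continuousOn_const (continuousOn_of_mem_volClass hα hσ)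
    (continuousOn_of_mem_volClass hα hτ) β (fun i => (gridVar_pos hα hm₀ hσ i).le)
    (fun i => (gridVar_pos hα hm₀ hτ i).le) (fun i => rfl) (fun i => ?_) (fun i => ?_) hA
  · rw [intervalIntegral.integral_const_mul]
    simp [gridVar]
  · have hint {σ : ℝ → ℝ} (hσ : σ ∈ volClass α m₀ M₀ L₀) :
        IntervalIntegrable (fun r => σ r ^ 2) volume ((i : ℝ) / n) (((i : ℝ) + 1) / n) :=
      ((continuousOn_sq_of_mem_volClass hα hσ).mono (by
        rw [Set.uIcc_of_le (grid_subset i).1]; exact (grid_subset i).2)).intervalIntegrable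
    rw [intervalIntegral.integral_add ((hint hσ).const_mul _) (hint hτ),
      intervalIntegral.integral_const_mul, Pi.zero_apply, mul_zero, add_zero, mul_pow,
      Real.sq_sqrt (gridVar_pos hα hm₀ hσ i).le]
    rfl

/-- If no event is much more likely under the null hypothesis than under all laws of a subfamily of
the alternative, then no test can separate the hypotheses. -/
lemma le_minimaxError [IsProbabilityMeasure P] (h : IsNoise P W W' X₀ Y₀) (hα : 0 < α)
    (hm₀ : 0 < m₀) (hσ : σ₀ ∈ volClass α m₀ M₀ L₀) (hτ : τ₀ ∈ volClass α m₀ M₀ L₀) {n : ℕ}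
    {H : Set (Measure (unitInterval → ℝ × ℝ))} {S : Set (Fin n → ℝ)} {c : ℝ} (hc0 : 0 ≤ c)
    (hS : ∀ l ∈ S, ∃ Q ∈ H, ∀ A : Set (Fin (n + 1) → ℝ × ℝ), MeasurableSet A →
      Q {w | observe n w ∈ A} = shearedLaw (P.map fun ω => (X₀ ω, Y₀ ω)) l
        (fromStandardized β (gridVar σ₀) (gridVar τ₀) ⁻¹' A))
    (htest : ∀ B : Set ((ℝ × ℝ) × (Fin n → ℝ × ℝ)), MeasurableSet B → ∃ l ∈ S,
      shearedLaw (P.map fun ω => (X₀ ω, Y₀ ω)) (0 : Fin n → ℝ) B ≤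
        shearedLaw (P.map fun ω => (X₀ ω, Y₀ ω)) l B + ENNReal.ofReal c) :
    ENNReal.ofReal (1 - c) ≤
      minimaxError n (pathLaw P W W' X₀ Y₀ (fun _ => β) σ₀ τ₀) H := by
  have : IsProbabilityMeasure (P.map fun ω => (X₀ ω, Y₀ ω)) :=
    Measure.isProbabilityMeasure_map
      (h.measurable_init_fst.prodMk h.measurable_init_snd).aemeasurable
  refine le_iInf₂ fun ψ hψ => ?_
  -- On the acceptance region `A`, the error sum is at least `1 - Q₀ A + Q A` for every alternative
  -- `Q`, and some `Q` has `Q₀ A ≤ Q A + c`.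
  set A : Set (Fin (n + 1) → ℝ × ℝ) := ψ ⁻¹' {0} with hA
  have hAm : MeasurableSet A := hψ (measurableSet_singleton 0)
  have hone : {w | ψ (observe n w) = 1} = {w : unitInterval → ℝ × ℝ | observe n w ∈ Aᶜ} := by
    ext w
    simp only [hA, Set.mem_ofPred_eq, Set.mem_compl_iff, Set.mem_preimage, Set.mem_singleton_iff]
    generalize ψ (observe n w) = x
    fin_cases x <;> simp
  set F := fromStandardized β (gridVar (n := n) σ₀) (gridVar τ₀)
  have hFm : MeasurableSet (F ⁻¹' A) := measurable_fromStandardized _ _ _ hAm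
  obtain ⟨l, hl, hle⟩ := htest _ hFm
  obtain ⟨Q, hQ, hQA⟩ := hS l hl
  have hQ' : Q {w | ψ (observe n w) = 0} = shearedLaw _ l (F ⁻¹' A) := hQA A hAm
  rw [hone, pathLaw_null h hα hm₀ hσ hτ hAm.compl, Set.preimage_compl, prob_compl_eq_one_sub hFm]
  refine le_trans ?_ (add_le_add_right (le_iSup₂ (f := fun (Q : Measure (unitInterval → ℝ × ℝ))
    (_ : Q ∈ H) => Q {w | ψ (observe n w) = 0}) Q hQ) _)
  rw [hQ']
  set p := shearedLaw (P.map fun ω => (X₀ ω, Y₀ ω)) (0 : Fin n → ℝ) (F ⁻¹' A)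
  set p' := shearedLaw (P.map fun ω => (X₀ ω, Y₀ ω)) l (F ⁻¹' A)
  have hp : p ≤ 1 := prob_le_one
  rcases le_total 1 c with hc | hc
  · rw [ENNReal.ofReal_of_nonpos (by linarith)]
    exact zero_le
  refine ENNReal.le_of_add_le_add_right (a := ENNReal.ofReal c) ENNReal.ofReal_ne_top ?_
  rw [← ENNReal.ofReal_add (by linarith) hc0, sub_add_cancel, ENNReal.ofReal_one, add_assoc]
  calc (1 : ℝ≥0∞) = 1 - p + p := (tsub_add_cancel_of_le hp).symm
    _ ≤ 1 - p + (p' + ENNReal.ofReal c) := by gcongr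

/-- The smallness conditions under which a perturbation of amplitude `a` at sample size `n` can be
realized within the alternative. -/
structure Admissible (α m L R β m₀ M₀ L₀ a : ℝ) (n : ℕ) : Prop where
  pos : 0 < n
  nonneg : 0 ≤ a
  holder : a * L₀ ≤ R * m₀ ^ 2 / 2
  bounded : a ≤ (R - β) * m₀
  sq_le : a ^ 2 ≤ m₀ * M₀
  holder_vol : 6 * (M₀ * R ^ 2) * (n : ℝ) ^ (-α) ≤ L - L₀
  lower_vol : 6 * (M₀ * R ^ 2) * (n : ℝ) ^ (-α) ≤ m₀ - m

/-- The constants `m`, `L₀` and `L` enter only through these conditions. As the amplitude tends to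
zero they merely delay the sample size from which the bound holds, so the separation constant need
not depend on them. -/
lemma eventually_admissible (hα : 0 < α) (hβ : 0 < β) (hβR : β < R) (hm₀ : 0 < m₀)
    (hM₀ : 0 < M₀) (hmm : m < m₀) (hLL : L₀ < L) {a : ℕ → ℝ} (ha0 : ∀ n, 0 ≤ a n)
    (ha : Tendsto a atTop (𝓝 0)) :
    ∀ᶠ n in atTop, Admissible α m L R β m₀ M₀ L₀ (a n) n := by
  have hR : 0 < R := hβ.trans hβR
  have h1 : Tendsto (fun n => a n * L₀) atTop (𝓝 0) := by simpa using ha.mul_const L₀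
  have h2 : Tendsto (fun n => a n ^ 2) atTop (𝓝 0) := by simpa using ha.pow 2
  have h3 : Tendsto (fun n : ℕ => 6 * (M₀ * R ^ 2) * (n : ℝ) ^ (-α)) atTop (𝓝 0) := by
    simpa using ((tendsto_rpow_neg_atTop hα).comp tendsto_natCast_atTop_atTop).const_mul
      (6 * (M₀ * R ^ 2))
  filter_upwards [eventually_gt_atTop 0,
    h1.eventually_le_const (by positivity : 0 < R * m₀ ^ 2 / 2),
    ha.eventually_le_const (mul_pos (sub_pos.2 hβR) hm₀),
    h2.eventually_le_const (mul_pos hm₀ hM₀), h3.eventually_le_const (sub_pos.2 hLL),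
    h3.eventually_le_const (sub_pos.2 hmm)] with n e0 e1 e2 e3 e4 e5
  exact ⟨e0, ha0 n, e1, e2, e3, e4, e5⟩

/-- Waves of admissible amplitude give rise to laws of the alternative. -/
lemma exists_mem_alternative [IsProbabilityMeasure P] (h : IsNoise P W W' X₀ Y₀) (hα : 0 < α)
    (hα' : α ≤ 1) (hβ : 0 < β) (hβR : β < R) (hm₀ : 0 < m₀) (hm : 0 < m) (hmm : m < m₀)
    (hMM : M₀ < M) (hLL : L₀ < L) (hσ : σ₀ ∈ volClass α m₀ M₀ L₀)
    (hτ : τ₀ ∈ volClass α m₀ M₀ L₀) {n : ℕ} {a : ℝ} (had : Admissible α m L R β m₀ M₀ L₀ a n)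
    {N : ℝ} (hN : 1 ≤ N) (haN : a * N ^ α ≤ R * m₀ / 2) {e : ℤ → ℝ} (he : ∀ k, |e k| = 1) {r : ℝ}
    (hr0 : 0 ≤ r) (hr : r ≤ a / (11 * M₀)) :
    ∃ Q ∈ alternative P W W' X₀ Y₀ α R m M L β r,
      ∀ A : Set (Fin (n + 1) → ℝ × ℝ), MeasurableSet A → Q {w | observe n w ∈ A} =
        shearedLaw (P.map fun ω => (X₀ ω, Y₀ ω))
          (fun i => (∫ t in ((i : ℝ) / n)..(((i : ℝ) + 1) / n), a * wave e (N * t)) /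
            (√(gridVar σ₀ i) * √(gridVar τ₀ i)))
          (fromStandardized β (gridVar σ₀) (gridVar τ₀) ⁻¹' A) := by
  have hM₀ : 0 < M₀ := by
    have := hσ.1 0 (by simp)
    linarith
  have hN0 : 0 ≤ N := zero_le_one.trans hN
  have ha := had.nonneg
  set g : ℝ → ℝ := fun t => a * wave e (N * t) with hg
  have hgh (s : ℝ) (_ : s ∈ Set.Icc (0 : ℝ) 1) (t : ℝ) (_ : t ∈ Set.Icc (0 : ℝ) 1) :
      |g t - g s| ≤ R * m₀ / 2 * |t - s| ^ α := by
    have hw := abs_wave_sub_le_rpow (fun k => (he k).le) hα hα' (N * t) (N * s)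
    rw [← mul_sub, abs_mul, abs_of_nonneg hN0, Real.mul_rpow hN0 (abs_nonneg _), one_mul] at hw
    simp only [hg]
    rw [← mul_sub, abs_mul, abs_of_nonneg ha]
    calc a * |wave e (N * t) - wave e (N * s)| ≤ a * (N ^ α * |t - s| ^ α) := by gcongr
      _ = a * N ^ α * |t - s| ^ α := by ring
      _ ≤ R * m₀ / 2 * |t - s| ^ α := by gcongr
  have hga (t : ℝ) (_ : t ∈ Set.Icc (0 : ℝ) 1) : |g t| ≤ a := by
    simp only [hg]
    rw [abs_mul, abs_of_nonneg ha]
    have := abs_wave_le (fun k => (he k).le) (N * t)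
    nlinarith
  obtain ⟨b, τ, hb, hτ', hsep, hint1, hint2⟩ := exists_alternative hα hα' hβ hβR hm₀ hm hmm hMM
    hσ hτ had.pos hgh hga had.holder had.bounded had.sq_le had.holder_vol had.lower_vol
  refine ⟨pathLaw P W W' X₀ Y₀ b σ₀ τ, ⟨b, σ₀, τ, hb, volClass_mono hmm.le hMM.le hLL.le hσ, hτ',
    le_trans ?_ hsep, rfl⟩, fun A hA => ?_⟩
  · have h1 : a ^ 2 / 60 ≤ ∫ t in (0 : ℝ)..1, g t ^ 2 := by
      simp only [hg, mul_pow]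
      rw [intervalIntegral.integral_const_mul]
      have := mul_le_mul_of_nonneg_left (le_integral_wave_sq he hN) (sq_nonneg a)
      linarith
    -- The constant `11` is chosen for `11² ≥ 120`, where `120` combines the wave's mass `1 / 60`
    -- with the factor `2` in the separation.
    calc r ^ 2 ≤ (a / (11 * M₀)) ^ 2 := pow_le_pow_left₀ hr0 hr 2
      _ = a ^ 2 / 121 / M₀ ^ 2 := by field_simp; norm_num
      _ ≤ a ^ 2 / 120 / M₀ ^ 2 := by gcongr; norm_num
      _ = a ^ 2 / 60 / (2 * M₀ ^ 2) := by field_simp; ring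
      _ ≤ _ := by gcongr
  · have hv := gridVar_pos hα hm₀ hσ (n := n)
    have hs := gridVar_pos hα hm₀ hτ (n := n)
    refine pathLaw_eq_shearedLaw h (continuousOn_of_holder hα hb.1)
      (continuousOn_of_mem_volClass hα hσ) (continuousOn_of_mem_volClass hα hτ') β
      (fun i => (hv i).le) (fun i => (hs i).le) (fun i => rfl) (fun i => ?_) (fun i => ?_) hA
    · rw [hint1 i, mul_div_cancel₀ _ (by have := hv i; have := hs i; positivity)]
      rfl
    · rw [hint2 i]
      have h1 := Real.sqrt_pos.2 (hv i)
      have h2 := Real.sqrt_pos.2 (hs i)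
      have h3 := Real.sq_sqrt (hv i).le
      set x := √(gridVar σ₀ i)
      set y := √(gridVar τ₀ i)
      change β ^ 2 * gridVar σ₀ i + 2 * β * (∫ t in ((i : ℝ) / n)..(((i : ℝ) + 1) / n), g t) +
        (∫ t in ((i : ℝ) / n)..(((i : ℝ) + 1) / n), g t) ^ 2 / gridVar σ₀ i + gridVar τ₀ i = _
      rw [← h3]
      field_simp
      ring

end LowerBound

/-! ### The two regimes of smoothness. -/

section Rates

variable {Ω : Type*} [MeasurableSpace Ω] {P : Measure Ω} {W W' : ℝ≥0 → Ω → ℝ} {X₀ Y₀ : Ω → ℝ}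
  {α m M L R β m₀ M₀ L₀ : ℝ} {σ₀ τ₀ : ℝ → ℝ}

/-- Alternating signs. -/
def altSign (k : ℤ) : ℝ := if Even k then 1 else -1

lemma abs_altSign (k : ℤ) : |altSign k| = 1 := by
  unfold altSign
  split_ifs <;> simp

/-- At frequency `2n` an observation interval holds exactly two cells, with opposite signs. -/
lemma integral_wave_altSign {n : ℕ} (i : Fin n) :
    ∫ t in ((i : ℝ) / n)..(((i : ℝ) + 1) / n), wave altSign (2 * n * t) = 0 := by
  have hn : (n : ℝ) ≠ 0 := by
    have := i.pos
    positivity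
  have h1 := integral_wave_grid altSign (⟨2 * i, by omega⟩ : Fin (2 * n))
  have h2 := integral_wave_grid altSign (⟨2 * i + 1, by omega⟩ : Fin (2 * n))
  push_cast at h1 h2
  have hc : Continuous fun t : ℝ => wave altSign (2 * n * t) :=
    (continuous_wave (C := 1) fun k => (abs_altSign k).le).comp (by fun_prop)
  have e1 : (i : ℝ) / n = 2 * (i : ℝ) / (2 * n) := by field_simp
  have e2 : ((i : ℝ) + 1) / n = (2 * (i : ℝ) + 1 + 1) / (2 * n) := by field_simp; ring
  rw [e1, e2, ← intervalIntegral.integral_add_adjacent_intervals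
    (hc.intervalIntegrable _ ((2 * (i : ℝ) + 1) / (2 * n))) (hc.intervalIntegrable _ _), h1, h2]
  have o1 : altSign (2 * (i : ℤ)) = 1 := if_pos (by simp)
  have o2 : altSign (2 * (i : ℤ) + 1) = -1 := if_neg (by simp)
  rw [o1, o2]
  ring

/-- For `α ≤ 1 / 4` there are perturbations of the separation `n ^ (-α)` that leave the law of the
observations unchanged. -/
lemma eventually_le_minimaxError_of_le_quarter [IsProbabilityMeasure P]
    (h : IsNoise P W W' X₀ Y₀) (hα : 0 < α) (hα' : α ≤ 1 / 4) (hβ : 0 < β) (hβR : β < R)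
    (hm₀ : 0 < m₀) (hm : 0 < m) (hmm : m < m₀) (hMM : M₀ < M) (hLL : L₀ < L)
    (hσ : σ₀ ∈ volClass α m₀ M₀ L₀) (hτ : τ₀ ∈ volClass α m₀ M₀ L₀) {c : ℝ} (hc : 0 ≤ c) :
    ∀ᶠ n : ℕ in atTop, ENNReal.ofReal (1 - c) ≤
      minimaxError n (pathLaw P W W' X₀ Y₀ (fun _ => β) σ₀ τ₀)
        (alternative P W W' X₀ Y₀ α R m M L β
          (R * m₀ / (44 * M₀) * (n : ℝ) ^ (-(2 * α) / (4 * α + 1)))) := by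
  have hR : 0 < R := hβ.trans hβR
  have hM₀ : 0 < M₀ := by
    have := hσ.1 0 (by simp)
    linarith
  -- The largest amplitude compatible with the Hölder bound at frequency `2n`.
  set a : ℕ → ℝ := fun n => R * m₀ / 2 * (2 * (n : ℝ)) ^ (-α) with ha
  have ha0 (n : ℕ) : 0 ≤ a n := by positivity
  have hlim : Tendsto a atTop (𝓝 0) := by
    have h2 : Tendsto (fun n : ℕ => 2 * (n : ℝ)) atTop atTop :=
      tendsto_natCast_atTop_atTop.const_mul_atTop two_pos
    simpa using ((tendsto_rpow_neg_atTop hα).comp h2).const_mul (R * m₀ / 2)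
  filter_upwards [eventually_admissible hα hβ hβR hm₀ hM₀ hmm hLL ha0 hlim] with n had
  have hn : (1 : ℝ) ≤ n := by exact_mod_cast had.pos
  have hn0 : (0 : ℝ) < n := by linarith
  -- The perturbed observations have the null law itself, so no averaging over signs is needed.
  refine le_minimaxError (S := {0}) h hα hm₀ hσ hτ hc (fun l hl => ?_)
    fun B _ => ⟨0, rfl, le_self_add⟩
  have hamp : a n * (2 * (n : ℝ)) ^ α ≤ R * m₀ / 2 := by
    simp only [ha]
    rw [mul_assoc, ← Real.rpow_add (by positivity), neg_add_cancel, Real.rpow_zero, mul_one]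
  have hrate : R * m₀ / (44 * M₀) * (n : ℝ) ^ (-(2 * α) / (4 * α + 1)) ≤ a n / (11 * M₀) := by
    -- The exponents compare this way because `4α + 1 ≤ 2`, which is where `α ≤ 1/4` enters.
    have h1 : (n : ℝ) ^ (-(2 * α) / (4 * α + 1)) ≤ (n : ℝ) ^ (-α) := by
      refine Real.rpow_le_rpow_of_exponent_le hn ?_
      rw [div_le_iff₀ (by positivity)]
      nlinarith
    have h2 : (1 / 2 : ℝ) ≤ 2 ^ (-α) := by
      rw [one_div, ← Real.rpow_neg_one]
      exact Real.rpow_le_rpow_of_exponent_le one_le_two (by linarith)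
    calc R * m₀ / (44 * M₀) * (n : ℝ) ^ (-(2 * α) / (4 * α + 1))
        ≤ R * m₀ / (44 * M₀) * (n : ℝ) ^ (-α) := by gcongr
      _ = R * m₀ / (22 * M₀) * (1 / 2 * (n : ℝ) ^ (-α)) := by field_simp; norm_num
      _ ≤ R * m₀ / (22 * M₀) * (2 ^ (-α) * (n : ℝ) ^ (-α)) := by gcongr
      _ = a n / (11 * M₀) := by
        simp only [ha]
        rw [Real.mul_rpow zero_le_two hn0.le]
        field_simp
        norm_num
  obtain ⟨Q, hQ, hQA⟩ := exists_mem_alternative h hα (by linarith) hβ hβR hm₀ hm hmm hMM hLL hσ hτ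
    had (by linarith) hamp abs_altSign (by positivity) hrate
  refine ⟨Q, hQ, fun A hA => ?_⟩
  rw [hQA A hA, Set.mem_singleton_iff.1 hl]
  congr 2
  ext i
  rw [intervalIntegral.integral_const_mul, integral_wave_altSign]
  simp

/-- Signs indexed by the integers, from finitely many Booleans. -/
noncomputable def extendSign {n : ℕ} (ε : Fin n → Bool) (k : ℤ) : ℝ :=
  if h : 0 ≤ k ∧ k < n then boolSign (ε ⟨k.toNat, by omega⟩) else 1

lemma abs_extendSign {n : ℕ} (ε : Fin n → Bool) (k : ℤ) : |extendSign ε k| = 1 := by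
  unfold extendSign
  split_ifs
  · exact abs_boolSign _
  · simp

/-- The block of length `K` to which an index belongs. -/
def block {n : ℕ} (K : ℕ) (i : Fin n) : Fin n := ⟨i / K, (Nat.div_le_self _ _).trans_lt i.2⟩

lemma extendSign_block {n : ℕ} (ε : Fin n → Bool) (K : ℕ) (i : Fin n) :
    extendSign ε (((i : ℕ) / K : ℕ) : ℤ) = boolSign (ε (block K i)) := by
  have hlt : (i : ℕ) / K < n := (block K i).2
  unfold extendSign
  rw [dif_pos ⟨by positivity, by exact_mod_cast hlt⟩]
  rfl

/-- Within a block an index is determined by its remainder modulo `K`. -/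
lemma card_block_le {n K : ℕ} (hK : 1 ≤ K) (j : Fin n) :
    (Finset.univ.filter fun i : Fin n => block K i = j).card ≤ K := by
  refine (Finset.card_le_card_of_injOn (fun i : Fin n => (i : ℕ) % K) (t := Finset.range K)
    (fun i _ => ?_) fun i hi i' hi' hii => ?_).trans (by simp)
  · simpa using Nat.mod_lt _ hK
  · have h1 : (i : ℕ) / K = j := congrArg Fin.val (by simpa using hi : block K i = j)
    have h2 : (i' : ℕ) / K = j := congrArg Fin.val (by simpa using hi' : block K i' = j)
    have h3 : (i : ℕ) % K = (i' : ℕ) % K := hii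
    rw [Fin.ext_iff, ← Nat.div_add_mod (i : ℕ) K, ← Nat.div_add_mod (i' : ℕ) K, h1, h2, h3]

/-- At frequency `n / K` the cells of the wave are the blocks of `K` observation intervals, so no
interval meets a sign change in its interior. `K` need not divide `n`; the last block may be
shorter. -/
lemma integral_wave_extendSign {n K : ℕ} (hK : 1 ≤ K) (ε : Fin n → Bool) (i : Fin n) :
    ∫ t in ((i : ℝ) / n)..(((i : ℝ) + 1) / n), wave (extendSign ε) (n / K * t) =
      boolSign (ε (block K i)) *
        ∫ t in ((i : ℝ) / n)..(((i : ℝ) + 1) / n), bump (n / K * t) := by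
  have hn : (0 : ℝ) < n := by exact_mod_cast i.pos
  have hK' : (0 : ℝ) < K := by exact_mod_cast hK
  rw [← intervalIntegral.integral_const_mul]
  refine intervalIntegral.integral_congr fun t ht => ?_
  rw [Set.uIcc_of_le (grid_subset i).1] at ht
  have h1 : (i : ℝ) ≤ n * t := by
    have := ht.1
    rwa [div_le_iff₀ hn, mul_comm] at this
  have h2 : n * t ≤ (i : ℝ) + 1 := by
    have := ht.2
    rwa [le_div_iff₀ hn, mul_comm] at this
  have h3 : (((i : ℕ) / K : ℕ) : ℝ) * K ≤ i := by exact_mod_cast Nat.div_mul_le_self _ _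
  have h4 : (i : ℝ) + 1 ≤ ((((i : ℕ) / K : ℕ) : ℝ) + 1) * K := by
    have := Nat.lt_div_mul_add (a := i) hK
    have h : (i : ℕ) + 1 ≤ ((i : ℕ) / K + 1) * K := by rw [add_mul]; omega
    exact_mod_cast h
  change wave (extendSign ε) _ = _ * bump _
  rw [← extendSign_block]
  have e : (n : ℝ) / K * t = n * t / K := by ring
  refine wave_eq _ ?_ ?_
  · rw [e, le_div_iff₀ hK']
    rw [Int.cast_natCast]
    linarith
  · rw [e, div_le_iff₀ hK']
    rw [Int.cast_natCast]
    linarith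

lemma abs_integral_bump_le {n : ℕ} (N : ℝ) (i : Fin n) :
    |∫ t in ((i : ℝ) / n)..(((i : ℝ) + 1) / n), bump (N * t)| ≤ 1 / n := by
  rw [← Real.norm_eq_abs]
  refine (intervalIntegral.norm_integral_le_of_norm_le_const (C := 1) fun t _ => ?_).trans ?_
  · rw [Real.norm_eq_abs, abs_of_nonneg (bump_nonneg _)]
    linarith [bump_le (N * t)]
  · rw [grid_length, one_mul, abs_of_nonneg (by positivity)]

/-- Perturbations with random signs on blocks of `K` observation intervals cannot be detected if
their amplitude `a` is small. -/
lemma le_minimaxError_of_blocks [IsProbabilityMeasure P] (h : IsNoise P W W' X₀ Y₀)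
    (hα : 0 < α) (hα' : α ≤ 1) (hβ : 0 < β) (hβR : β < R) (hm₀ : 0 < m₀) (hm : 0 < m)
    (hmm : m < m₀) (hMM : M₀ < M) (hLL : L₀ < L) (hσ : σ₀ ∈ volClass α m₀ M₀ L₀)
    (hτ : τ₀ ∈ volClass α m₀ M₀ L₀) {n : ℕ} {a : ℝ} (had : Admissible α m L R β m₀ M₀ L₀ a n)
    {K : ℕ} (hK : 1 ≤ K) (hKn : K ≤ n) (haK : a * ((n : ℝ) / K) ^ α ≤ R * m₀ / 2) {r : ℝ}
    (hr0 : 0 ≤ r) (hr : r ≤ a / (11 * M₀)) {ρ : ℝ} (haρ : (a / m₀) ^ 2 ≤ ρ) (hρ : ρ ≤ 1 / 4)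
    {c : ℝ} (hc : 0 < c) (hsmall : Real.exp (5 / 2 * (n * K * ρ ^ 2)) ≤ 1 + c ^ 2) :
    ENNReal.ofReal (1 - c) ≤ minimaxError n (pathLaw P W W' X₀ Y₀ (fun _ => β) σ₀ τ₀)
      (alternative P W W' X₀ Y₀ α R m M L β r) := by
  have : IsProbabilityMeasure (P.map fun ω => (X₀ ω, Y₀ ω)) :=
    Measure.isProbabilityMeasure_map
      (h.measurable_init_fst.prodMk h.measurable_init_snd).aemeasurable
  have hn : (0 : ℝ) < n := by exact_mod_cast had.pos
  have hK' : (0 : ℝ) < K := by exact_mod_cast hK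
  have hN : (1 : ℝ) ≤ n / K := by
    rw [one_le_div hK']
    exact_mod_cast hKn
  have ha := had.nonneg
  set lam : Fin n → ℝ := fun i =>
    a * (∫ t in ((i : ℝ) / n)..(((i : ℝ) + 1) / n), bump (n / K * t)) /
      (√(gridVar σ₀ i) * √(gridVar τ₀ i)) with hlam
  have hlamρ (i : Fin n) : lam i ^ 2 ≤ ρ := by
    -- A coefficient is at most `a / m₀` in modulus: the integral is at most `a / n`, and the null
    -- standard deviations multiply to at least `m₀ / n`.
    refine le_trans ?_ haρ
    have hv : m₀ / n ≤ gridVar σ₀ i := le_gridIntegral_sq hα hσ i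
    have hs : m₀ / n ≤ gridVar τ₀ i := le_gridIntegral_sq hα hτ i
    have hpos : 0 < m₀ / n := by positivity
    have hden : m₀ / n ≤ √(gridVar σ₀ i) * √(gridVar τ₀ i) := by
      rw [← Real.sqrt_mul (hpos.le.trans hv)]
      refine Real.le_sqrt_of_sq_le ?_
      rw [sq]
      exact mul_le_mul hv hs hpos.le (hpos.le.trans hv)
    rw [← sq_abs]
    refine pow_le_pow_left₀ (abs_nonneg _) ?_ 2
    simp only [hlam]
    rw [abs_div, abs_mul, abs_of_nonneg ha, abs_of_pos (hpos.trans_le hden)]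
    calc _ ≤ a * (1 / n) / (m₀ / n) := by
          gcongr
          exact abs_integral_bump_le _ i
      _ = a / m₀ := by field_simp
  refine le_minimaxError (S := Set.range fun (ε : Fin n → Bool) (i : Fin n) =>
    boolSign (ε (block K i)) * lam i) h hα hm₀ hσ hτ hc.le ?_ fun B hB => ?_
  · rintro _ ⟨ε, rfl⟩
    obtain ⟨Q, hQ, hQA⟩ := exists_mem_alternative h hα hα' hβ hβR hm₀ hm hmm hMM hLL hσ hτ had hN
      haK (abs_extendSign ε) hr0 hr
    refine ⟨Q, hQ, fun A hA => ?_⟩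
    rw [hQA A hA]
    congr 2
    ext i
    rw [intervalIntegral.integral_const_mul, integral_wave_extendSign hK]
    simp only [hlam]
    ring
  · obtain ⟨ε, hε⟩ := exists_sign_measure_le (P.map fun ω => (X₀ ω, Y₀ ω)) (block K) lam hρ hlamρ
      hK (card_block_le hK) hc hsmall hB
    exact ⟨_, ⟨ε, rfl⟩, hε⟩

/-- For `α > 1 / 4`, perturbations with random signs on blocks of length `n ^ (-2 / (4 α + 1))`
cannot be detected. -/
lemma eventually_le_minimaxError_of_quarter_lt [IsProbabilityMeasure P]
    (h : IsNoise P W W' X₀ Y₀) (hα : 1 / 4 < α) (hα' : α ≤ 1) (hβ : 0 < β) (hβR : β < R)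
    (hm₀ : 0 < m₀) (hm : 0 < m) (hmm : m < m₀) (hMM : M₀ < M) (hLL : L₀ < L)
    (hσ : σ₀ ∈ volClass α m₀ M₀ L₀) (hτ : τ₀ ∈ volClass α m₀ M₀ L₀) {c : ℝ} (hc : 0 < c) {κ : ℝ}
    (hκ : 0 < κ) (hκ2 : κ ≤ 1 / 2) (hκc : 5 * (R / 2) ^ 4 * κ ≤ Real.log (1 + c ^ 2)) :
    ∀ᶠ n : ℕ in atTop, ENNReal.ofReal (1 - c) ≤
      minimaxError n (pathLaw P W W' X₀ Y₀ (fun _ => β) σ₀ τ₀)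
        (alternative P W W' X₀ Y₀ α R m M L β
          (R * m₀ * κ ^ α / (22 * M₀) * (n : ℝ) ^ (-(2 * α) / (4 * α + 1)))) := by
  have hR : 0 < R := hβ.trans hβR
  have hα0 : 0 < α := by linarith
  have hM₀ : 0 < M₀ := by
    have := hσ.1 0 (by simp)
    linarith
  -- With this exponent `n² (K / n)^(4α+1)` stays bounded. The condition `α > 1/4` says `p < 1`, so
  -- block sizes tend to infinity and rounding up at most doubles them eventually.
  set p : ℝ := 2 / (4 * α + 1) with hp
  have hp0 : 0 < p := by positivity
  have hp1 : 0 < 1 - p := by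
    rw [sub_pos, hp, div_lt_one (by positivity)]
    linarith
  set K : ℕ → ℕ := fun n => ⌈κ * (n : ℝ) ^ (1 - p)⌉₊ with hKdef
  set a : ℕ → ℝ := fun n => R * m₀ / 2 * ((K n : ℝ) / n) ^ α with ha
  have ha0 (n : ℕ) : 0 ≤ a n := by positivity
  have hlarge : ∀ᶠ n : ℕ in atTop, 1 ≤ κ * (n : ℝ) ^ (1 - p) :=
    (((tendsto_rpow_atTop hp1).comp tendsto_natCast_atTop_atTop).const_mul_atTop
      hκ).eventually_ge_atTop 1
  have hbounds : ∀ᶠ n : ℕ in atTop, κ * (n : ℝ) ^ (-p) ≤ (K n : ℝ) / n ∧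
      (K n : ℝ) / n ≤ 2 * κ * (n : ℝ) ^ (-p) := by
    filter_upwards [hlarge, eventually_gt_atTop 0] with n hn1 hn0
    have hn : (0 : ℝ) < n := by exact_mod_cast hn0
    have e : (n : ℝ) ^ (1 - p) = (n : ℝ) ^ (-p) * n := by
      rw [sub_eq_neg_add, Real.rpow_add hn, Real.rpow_one]
    have h1 := Nat.le_ceil (κ * (n : ℝ) ^ (1 - p))
    have h2 := Nat.ceil_lt_add_one (zero_le_one.trans hn1)
    rw [le_div_iff₀ hn, div_le_iff₀ hn, mul_assoc, mul_assoc, ← e]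
    exact ⟨h1, by simp only [hKdef]; linarith⟩
  have hh : Tendsto (fun n => (K n : ℝ) / n) atTop (𝓝 0) := by
    have hz : Tendsto (fun n : ℕ => 2 * κ * (n : ℝ) ^ (-p)) atTop (𝓝 0) := by
      simpa using ((tendsto_rpow_neg_atTop hp0).comp tendsto_natCast_atTop_atTop).const_mul (2 * κ)
    exact tendsto_of_tendsto_of_tendsto_of_le_of_le' tendsto_const_nhds hz
      (Eventually.of_forall fun n => by positivity) (hbounds.mono fun n hn => hn.2)
  have hlim : Tendsto a atTop (𝓝 0) := by
    have := (hh.rpow_const (Or.inr hα0.le : (0 : ℝ) ≠ 0 ∨ 0 ≤ α)).const_mul (R * m₀ / 2)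
    simpa [Real.zero_rpow hα0.ne'] using this
  have hρlim : Tendsto (fun n => (a n / m₀) ^ 2) atTop (𝓝 0) := by
    simpa using (hlim.div_const m₀).pow 2
  filter_upwards [eventually_admissible hα0 hβ hβR hm₀ hM₀ hmm hLL ha0 hlim, hlarge, hbounds,
    hh.eventually_le_const one_pos, hρlim.eventually_le_const (by norm_num : (0 : ℝ) < 1 / 4)]
    with n had hn1 hb hle hρ
  have hn : (0 : ℝ) < n := by exact_mod_cast had.pos
  have hK : 1 ≤ K n := Nat.one_le_ceil_iff.2 (by linarith)
  have hK' : (0 : ℝ) < K n := by exact_mod_cast hK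
  have hh0 : 0 < (K n : ℝ) / n := by positivity
  refine le_minimaxError_of_blocks h hα0 hα' hβ hβR hm₀ hm hmm hMM hLL hσ hτ had hK ?_ ?_
    (by positivity) ?_ le_rfl hρ hc ?_
  · rw [div_le_one hn] at hle
    exact_mod_cast hle
  · simp only [ha]
    rw [mul_assoc, ← Real.mul_rpow hh0.le (by positivity), div_mul_div_cancel₀ hn.ne',
      div_self hK'.ne', Real.one_rpow, mul_one]
  · have e : (n : ℝ) ^ (-(2 * α) / (4 * α + 1)) = ((n : ℝ) ^ (-p)) ^ α := by
      rw [← Real.rpow_mul hn.le]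
      congr 1
      rw [hp]
      ring
    rw [e]
    calc R * m₀ * κ ^ α / (22 * M₀) * ((n : ℝ) ^ (-p)) ^ α
        = R * m₀ / (22 * M₀) * (κ * (n : ℝ) ^ (-p)) ^ α := by
          rw [Real.mul_rpow hκ.le (by positivity)]
          ring
      _ ≤ R * m₀ / (22 * M₀) * ((K n : ℝ) / n) ^ α := by
          gcongr
          exact hb.1
      _ = a n / (11 * M₀) := by
          simp only [ha]
          field_simp
          norm_num
  · rw [← Real.le_log_iff_exp_le (by positivity)]
    refine le_trans ?_ hκc
    set x : ℝ := (K n : ℝ) / n with hx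
    have hKx : (K n : ℝ) = x * n := by rw [hx, div_mul_cancel₀ _ hn.ne']
    have hax : a n / m₀ = R / 2 * x ^ α := by
      simp only [ha, ← hx]
      field_simp
    have hx4 : (x ^ α) ^ 4 * x = x ^ (4 * α + 1) := by
      rw [Real.rpow_add hh0, Real.rpow_one, mul_comm 4 α, Real.rpow_mul hh0.le]
      norm_cast
    have hpow : x ^ (4 * α + 1) ≤ 2 * κ * ((n : ℝ) ^ 2)⁻¹ := by
      calc x ^ (4 * α + 1) ≤ (2 * κ * (n : ℝ) ^ (-p)) ^ (4 * α + 1) := by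
            gcongr
            exact hb.2
        _ = (2 * κ) ^ (4 * α + 1) * ((n : ℝ) ^ 2)⁻¹ := by
            rw [Real.mul_rpow (by positivity) (by positivity), ← Real.rpow_mul hn.le,
              show -p * (4 * α + 1) = -2 by rw [hp]; field_simp, Real.rpow_neg hn.le]
            norm_cast
        _ ≤ 2 * κ * ((n : ℝ) ^ 2)⁻¹ := by
            gcongr
            -- The bound `κ ≤ 1/2` makes `(2κ)^(4α+1) ≤ 2κ`.
            exact Real.rpow_le_self_of_le_one (by positivity) (by linarith) (by linarith)
    rw [hax, hKx]
    calc 5 / 2 * (n * (x * n) * ((R / 2 * x ^ α) ^ 2) ^ 2)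
        = 5 / 2 * (R / 2) ^ 4 * (n : ℝ) ^ 2 * ((x ^ α) ^ 4 * x) := by ring
      _ ≤ 5 / 2 * (R / 2) ^ 4 * (n : ℝ) ^ 2 * (2 * κ * ((n : ℝ) ^ 2)⁻¹) := by
          rw [hx4]
          gcongr
      _ = 5 * (R / 2) ^ 4 * κ := by field_simp

end Rates

end ConstantBeta

/-! ### The theorem: choice of the separation constant. -/

theorem theorem4 {Ω : Type*} [MeasurableSpace Ω] (P : Measure Ω) [IsProbabilityMeasure P]
    (W W' : ℝ≥0 → Ω → ℝ) (X₀ Y₀ : Ω → ℝ) (hW : ConstantBeta.IsNoise P W W' X₀ Y₀)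
    (α γ R β m₀ M₀ : ℝ) (hα : 0 < α) (hα' : α ≤ 1) (hγ : 0 < γ) (hγ' : γ < 1)
    (hβ : 0 < β) (hβR : β < R) (hm₀ : 0 < m₀) :
    ∃ Γ : ℝ, 0 < Γ ∧
      ∀ m M L₀ L : ℝ, 0 < m → m < m₀ → M₀ < M → L₀ < L →
      ∀ σ₀ ∈ ConstantBeta.volClass α m₀ M₀ L₀, ∀ τ₀ ∈ ConstantBeta.volClass α m₀ M₀ L₀,
        ENNReal.ofReal γ ≤ liminf (fun n : ℕ =>
          ConstantBeta.minimaxError n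
            (ConstantBeta.pathLaw P W W' X₀ Y₀ (fun _ => β) σ₀ τ₀)
            (ConstantBeta.alternative P W W' X₀ Y₀ α R m M L β
              (Γ * (n : ℝ) ^ (-(2 * α) / (4 * α + 1))))) atTop := by
  have hR : 0 < R := hβ.trans hβR
  have hγc : ENNReal.ofReal γ = ENNReal.ofReal (1 - (1 - γ)) := by rw [sub_sub_cancel]
  have hc : 0 < 1 - γ := sub_pos.2 hγ'
  rcases lt_or_ge M₀ m₀ with hlt | hge
  -- If `M₀ < m₀` no null volatility exists, so any constant serves.
  · refine ⟨1, one_pos, fun m M L₀ L _ _ _ _ σ₀ hσ => ?_⟩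
    have := hσ.1 0 (by simp)
    linarith
  have hM₀ : 0 < M₀ := hm₀.trans_le hge
  rw [hγc]
  rcases le_or_gt α (1 / 4) with hq | hq
  · exact ⟨R * m₀ / (44 * M₀), by positivity,
      fun m M L₀ L hm hmm hMM hLL σ₀ hσ τ₀ hτ => le_liminf_of_le isCobounded_ge_of_top
        (ConstantBeta.eventually_le_minimaxError_of_le_quarter hW hα hq hβ hβR hm₀ hm hmm hMM hLL
          hσ hτ hc.le)⟩
  · have hlog : 0 < Real.log (1 + (1 - γ) ^ 2) := Real.log_pos (by nlinarith)
    -- The second entry makes the likelihood's second moment at most `1 + (1 - γ)²`; the first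
    -- controls powers of `2κ`.
    set κ : ℝ := min (1 / 2) (Real.log (1 + (1 - γ) ^ 2) / (5 * (R / 2) ^ 4)) with hκdef
    have hκ : 0 < κ := lt_min (by norm_num) (by positivity)
    have hκc : 5 * (R / 2) ^ 4 * κ ≤ Real.log (1 + (1 - γ) ^ 2) := by
      rw [mul_comm, ← le_div_iff₀ (by positivity)]
      exact min_le_right _ _
    exact ⟨R * m₀ * κ ^ α / (22 * M₀), by positivity,
      fun m M L₀ L hm hmm hMM hLL σ₀ hσ τ₀ hτ => le_liminf_of_le isCobounded_ge_of_top
        (ConstantBeta.eventually_le_minimaxError_of_quarter_lt hW hq hα' hβ hβR hm₀ hm hmm hMM hLL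
          hσ hτ hc hκ (min_le_left _ _) hκc)⟩
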